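/- For integers $n,s\ge 1$ let $t_s(n)$ be the number of edges of the balanced complete $s$-partite graph on $n$ vertices. Let $N(K_r,G)$ be the number of $r$-cliques in a graph $G$. Let $n,e\ge 1$ be integers with $e\le\binom n2$. Put $k=k(n,e):=\min\{s\ge 1: t_s(n)\ge e\}$. Define the vector $(a_1^*,\dots,a_k^*)$ of positive integers by $$a_k^*:=\min\{a\ge 1: a(n-a)+t_{k-1}(n-a)\ge e\},\qquad a_1^*+\dots+a_{k-1}^*=n-a_k^*,\qquad a_1^*\ge\dots\ge a_{k-1}^*\ge a_1^*-1 .$$ Put $$m^*:=\sum_{1\le i<j\le k}a_i^*a_j^*-e,\qquad h_r^*(n,e):=\sum_{I\subseteq\{1,\dots,k\},\,|I|=r}\ \prod_{i\in I}a_i^*\;-\;m^*\sum_{I\subseteq\{1,\dots,k-2\},\,|I|=r-2}\ \prod_{i\in I}a_i^* .$$ Let $\mathcal K(n,e)$ be the family of graphs with $n$ vertices and $e$ edges that can be obtained from a complete multipartite graph (with any number $\ell\ge 1$ of parts) by adding a (possibly empty) triangle-free graph into one part. Let $T$ be the complete $k$-partite graph with parts $A_1^*,\dots,A_k^*$, where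 $|A_i^*|=a_i^*$. The family $\mathcal H_1^*(n,e)$ is defined as follows. If $m^*=0$, it consists of all graphs obtained from $T$ by replacing, for some $i\in\{1,\dots,k-1\}$, the induced subgraph $T[A_i^*\cup A_k^*]$ with an arbitrary triangle-free graph with $a_i^*a_k^*$ edges. If $m^*>0$, it consists of all graphs obtained from $T$ by replacing $T[A_{k-1}^*\cup A_k^*]$ with an arbitrary triangle-free graph with $a_{k-1}^*a_k^*-m^*$ edges. **Theorem.** Let $r,n,e$ be positive integers with $n\ge r\ge 3$ and $e\le\binom n2$. Then $$\min\{N(K_r,G): G\in\mathcal K(n,e)\}=h_r^*(n,e).$$ Moreover, if $r\ge 4$ and $e>t_{r-1}(n)$, then $$\{G\in\mathcal K(n,e): N(K_r,G)=h_r^*(n,e)\}=\mathcal H_1^*(n,e).$$ -/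

import Mathlib

namespace ErdosRademacher

/-- `t_s(n)`: the number of edges of the balanced complete `s`-partite graph on `n` vertices. -/
def turanNumber (s n : ℕ) : ℕ := (SimpleGraph.turanGraph n s).edgeFinset.card

/-- `N(K_r, G)`: the number of `r`-cliques of `G`. -/
noncomputable def cliqueCount {n : ℕ} (r : ℕ) (G : SimpleGraph (Fin n)) : ℕ :=
  (G.cliqueSet r).ncard

/-- The complete multipartite graph whose parts are the fibres of `c`. -/
def multipartite {V ι : Type*} (c : V → ι) : SimpleGraph V :=
  (⊤ : SimpleGraph ι).comap c

/-- `𝒦(n, e)`: the graphs with vertex set `Fin n` and `e` edges that are obtained from a complete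
`ℓ`-partite graph (for some `ℓ`, with non-empty parts `c ⁻¹' {i}`) by adding a triangle-free
graph `J` into one part `c ⁻¹' {p}`. -/
def familyK (n e : ℕ) : Set (SimpleGraph (Fin n)) :=
  {G | G.edgeSet.ncard = e ∧
    ∃ (l : ℕ) (c : Fin n → Fin l) (p : Fin l) (J : SimpleGraph (Fin n)),
      Function.Surjective c ∧ J.CliqueFree 3 ∧
      (∀ u v, J.Adj u v → c u = p ∧ c v = p) ∧ G = multipartite c ⊔ J}

/-- `k(n, e)`: the least positive `s` with `t_s(n) ≥ e`. -/
noncomputable def chromaticParam (n e : ℕ) : ℕ :=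
  sInf {s : ℕ | 1 ≤ s ∧ e ≤ turanNumber s n}

/-- `a_k^*`: the least positive `a` with `a (n - a) + t_{k-1}(n - a) ≥ e`, where `k = k(n, e)`. -/
noncomputable def smallestPart (n e : ℕ) : ℕ :=
  sInf {a : ℕ | 1 ≤ a ∧ e ≤ a * (n - a) + turanNumber (chromaticParam n e - 1) (n - a)}

/-- The `i`-th entry (`1 ≤ i ≤ s`) of the unique vector of `s` integers with sum `N` that satisfies
`b_1 ≥ ⋯ ≥ b_s ≥ b_1 - 1`; see the three lemmas below. -/
def balancedPart (N s i : ℕ) : ℕ := (N + s - i) / s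

lemma balancedPart_antitone (N s : ℕ) {i j : ℕ} (hij : i ≤ j) :
    balancedPart N s j ≤ balancedPart N s i :=
  Nat.div_le_div_right (Nat.sub_le_sub_left hij _)

lemma balancedPart_one_le (N s : ℕ) (hs : 1 ≤ s) :
    balancedPart N s 1 ≤ balancedPart N s s + 1 := by
  unfold balancedPart
  rw [Nat.add_sub_cancel, ← Nat.add_div_right N hs]
  exact Nat.div_le_div_right (Nat.sub_le _ _)

lemma sum_balancedPart (N s : ℕ) (hs : 1 ≤ s) :
    ∑ i ∈ Finset.Icc 1 s, balancedPart N s i = N := by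
  induction N using Nat.strong_induction_on with
  | _ N ih =>
    by_cases h : N < s
    · have h1 : ∀ i ∈ Finset.Icc 1 s, balancedPart N s i = if i ≤ N then 1 else 0 := by
        intro i hi
        rw [Finset.mem_Icc] at hi
        unfold balancedPart
        split_ifs with hiN
        · exact Nat.div_eq_of_lt_le (by omega) (by omega)
        · exact Nat.div_eq_of_lt (by omega)
      rw [Finset.sum_congr rfl h1, ← Finset.sum_filter, Finset.sum_const, smul_eq_mul, mul_one]
      have h2 : (Finset.Icc 1 s).filter (fun i => i ≤ N) = Finset.Icc 1 N := by
        ext i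
        simp only [Finset.mem_filter, Finset.mem_Icc]
        omega
      rw [h2, Nat.card_Icc]
      omega
    · have h1 : ∀ i ∈ Finset.Icc 1 s, balancedPart N s i = balancedPart (N - s) s i + 1 := by
        intro i hi
        rw [Finset.mem_Icc] at hi
        unfold balancedPart
        rw [← Nat.add_div_right _ hs]
        congr 1
        omega
      rw [Finset.sum_congr rfl h1, Finset.sum_add_distrib, ih (N - s) (by omega)]
      simp only [Finset.sum_const, Nat.card_Icc, smul_eq_mul]
      omega

/-- The entries `a_1^*, …, a_k^*` of the vector `a^*(n, e)`, indexed by `1, …, k`. -/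
noncomputable def starPart (n e i : ℕ) : ℕ :=
  if i = chromaticParam n e then smallestPart n e
  else balancedPart (n - smallestPart n e) (chromaticParam n e - 1) i

/-- `∑_{I ⊆ {1, …, s}, |I| = q} ∏_{i ∈ I} a_i^*`. -/
noncomputable def starSum (n e s q : ℕ) : ℕ :=
  ∑ I ∈ (Finset.Icc 1 s).powersetCard q, ∏ i ∈ I, starPart n e i

/-- `m^*(n, e)`. -/
noncomputable def mStar (n e : ℕ) : ℤ := (starSum n e (chromaticParam n e) 2 : ℤ) - (e : ℤ)

/-- `h_r^*(n, e)`. -/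
noncomputable def hStar (r n e : ℕ) : ℤ :=
  (starSum n e (chromaticParam n e) r : ℤ) -
    mStar n e * (starSum n e (chromaticParam n e - 2) (r - 2) : ℤ)

/-- `G` is obtained from `T` by replacing the induced subgraph `T[S]` with a triangle-free graph
that has `q` edges. -/
def IsTriangleFreeReplacement {V : Type*} (T : SimpleGraph V) (S : Set V) (q : ℤ)
    (G : SimpleGraph V) : Prop :=
  (G.induce S).CliqueFree 3 ∧ ((G.induce S).edgeSet.ncard : ℤ) = q ∧
    ∀ u v, ¬ (u ∈ S ∧ v ∈ S) → (G.Adj u v ↔ T.Adj u v)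

/-- `ℋ₁^*(n, e)` on the vertex set `Fin n`. The parts `A_i^*` (`1 ≤ i ≤ k`) of the complete
`k`-partite graph `T` are the fibres of `c`. -/
def familyHOneStar (n e : ℕ) : Set (SimpleGraph (Fin n)) :=
  {G | ∃ c : Fin n → ℕ,
    (∀ v, c v ∈ Finset.Icc 1 (chromaticParam n e)) ∧
    (∀ i ∈ Finset.Icc 1 (chromaticParam n e), (c ⁻¹' {i}).ncard = starPart n e i) ∧
    ((mStar n e = 0 ∧ ∃ i ∈ Finset.Icc 1 (chromaticParam n e - 1),
        IsTriangleFreeReplacement (multipartite c) (c ⁻¹' {i, chromaticParam n e})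
          ((starPart n e i : ℤ) * starPart n e (chromaticParam n e)) G) ∨
      (0 < mStar n e ∧
        IsTriangleFreeReplacement (multipartite c)
          (c ⁻¹' {chromaticParam n e - 1, chromaticParam n e})
          ((starPart n e (chromaticParam n e - 1) : ℤ) * starPart n e (chromaticParam n e)
            - mStar n e) G))}

end ErdosRademacher

/-! Encode a graph by its clique polynomial, whose coefficient at X^r is the number of r-cliques.
Joins become products, so a graph in 𝒦(n, e) whose complete parts have sizes R and whose
triangle-free part has b vertices and q edges has polynomial ∏(1 + cX) · (1 + bX + qX²). Only the
configuration (R, b, q) matters, and Mantel's bound 4q ≤ b² is the only restriction on q.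

Pair one part c with the triangle-free part: (1 + cX)(1 + bX + qX²) has coefficients c + b, cb + q
and cq. Fixing the first two fixes n and e, and then every clique number is monotone in the single
integer cq. Two moves lower it: merging c into the triangle-free part makes it 0 and is allowed when
Mantel's bound survives, while otherwise c can be changed (`exists_better`). Write b = x + y and q =
xy - m with m ≤ x - y (`exists_canonical`). The moves get stuck only when every part in R is x or x
+ 1. By a convexity estimate for Turán numbers such a star configuration is the one given by the
a_i^* (`IsStar.isStarData`), so it minimises all clique numbers at once.

For uniqueness, e > t_{r-1}(n) forces enough parts for a drop in cq to be a strict drop in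
r-cliques. A minimiser is then a star configuration, possibly after re-choosing which two parts of a
complete multipartite graph form the triangle-free part. Mantel's uniqueness settles the case where
the original choice of the two parts is not one allowed in ℋ₁^*. -/

namespace ErdosRademacher
open Polynomial

/-! ### Clique polynomials of joins -/

/-- The clique polynomial of the complete multipartite graph whose part sizes are the entries
of `R`. -/
noncomputable def joinPoly (R : Multiset ℕ) : ℤ[X] :=
  (R.map fun c : ℕ => 1 + C (c : ℤ) * X).prod

/-- The clique polynomial of the join of a complete multipartite graph with part sizes `R` and a
triangle-free graph with `b` vertices and `q` edges. -/
noncomputable def cliquePoly (R : Multiset ℕ) (b q : ℕ) : ℤ[X] :=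
  joinPoly R * (1 + C (b : ℤ) * X + C (q : ℤ) * X ^ 2)

@[simp] lemma joinPoly_zero : joinPoly 0 = 1 := by simp [joinPoly]

@[simp] lemma joinPoly_cons (c : ℕ) (R : Multiset ℕ) :
    joinPoly (c ::ₘ R) = (1 + C (c : ℤ) * X) * joinPoly R := by simp [joinPoly]

lemma coeff_one_add_mul_zero (a : ℤ) (P : ℤ[X]) :
    ((1 + C a * X) * P).coeff 0 = P.coeff 0 := by
  simp [add_mul, mul_assoc]

lemma coeff_one_add_mul_succ (a : ℤ) (P : ℤ[X]) (j : ℕ) :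
    ((1 + C a * X) * P).coeff (j + 1) = P.coeff (j + 1) + a * P.coeff j := by
  simp [add_mul, mul_assoc, coeff_X_mul]

lemma joinPoly_coeff_zero (R : Multiset ℕ) : (joinPoly R).coeff 0 = 1 := by
  induction R using Multiset.induction_on with
  | empty => simp
  | cons c R ih => rw [joinPoly_cons, coeff_one_add_mul_zero, ih]

lemma joinPoly_coeff_nonneg (R : Multiset ℕ) (j : ℕ) : 0 ≤ (joinPoly R).coeff j := by
  induction R using Multiset.induction_on generalizing j with
  | empty => rw [joinPoly_zero, coeff_one]; split_ifs <;> simp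
  | cons c R ih =>
    rw [joinPoly_cons]
    cases j with
    | zero => rw [coeff_one_add_mul_zero]; exact ih 0
    | succ j =>
      rw [coeff_one_add_mul_succ]
      exact add_nonneg (ih _) (mul_nonneg (Int.natCast_nonneg _) (ih _))

lemma joinPoly_coeff_pos (R : Multiset ℕ) (hR : ∀ c ∈ R, 1 ≤ c) (j : ℕ) (hj : j ≤ R.card) :
    0 < (joinPoly R).coeff j := by
  induction R using Multiset.induction_on generalizing j with
  | empty =>
    obtain rfl : j = 0 := by simpa using hj
    simp
  | cons c R ih =>
    have hR' : ∀ d ∈ R, 1 ≤ d := fun d hd => hR d (Multiset.mem_cons_of_mem hd)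
    have hc : 1 ≤ c := hR c (Multiset.mem_cons_self c R)
    rw [joinPoly_cons]
    cases j with
    | zero => rw [coeff_one_add_mul_zero]; exact ih hR' 0 (Nat.zero_le _)
    | succ j =>
      rw [coeff_one_add_mul_succ]
      rw [Multiset.card_cons] at hj
      exact add_pos_of_nonneg_of_pos (joinPoly_coeff_nonneg _ _)
        (mul_pos (by exact_mod_cast hc) (ih hR' j (by omega)))

lemma joinPoly_coeff_one (R : Multiset ℕ) : (joinPoly R).coeff 1 = (R.sum : ℤ) := by
  induction R using Multiset.induction_on with
  | empty => simp [coeff_one]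
  | cons c R ih =>
    rw [joinPoly_cons, coeff_one_add_mul_succ, ih, joinPoly_coeff_zero, Multiset.sum_cons]
    push_cast; ring

lemma two_mul_joinPoly_coeff_two (R : Multiset ℕ) :
    2 * (joinPoly R).coeff 2 = (R.sum : ℤ) ^ 2 - ((R.map fun c => c ^ 2).sum : ℕ) := by
  induction R using Multiset.induction_on with
  | empty => simp [coeff_one]
  | cons c R ih =>
    rw [joinPoly_cons, coeff_one_add_mul_succ, mul_add, ih, joinPoly_coeff_one, Multiset.sum_cons,
      Multiset.map_cons, Multiset.sum_cons]
    push_cast; ring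

lemma cliquePoly_cons (c : ℕ) (R : Multiset ℕ) (b q : ℕ) :
    cliquePoly (c ::ₘ R) b q =
      cliquePoly R (c + b) (c * b + q) + C ((c * q : ℕ) : ℤ) * joinPoly R * X ^ 3 := by
  simp only [cliquePoly, joinPoly_cons, Nat.cast_add, Nat.cast_mul, map_add, map_mul]
  ring

/-- The two sides agree below degree 3, so the vertex and edge numbers are kept. Since `joinPoly R`
has nonnegative coefficients, the sign of cq - c'q' decides the comparison for all r simultaneously.
-/
lemma cliquePoly_cons_swap {c b q c' b' q' : ℕ} (R : Multiset ℕ) (h1 : c' + b' = c + b)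
    (h2 : c' * b' + q' = c * b + q) :
    cliquePoly (c ::ₘ R) b q = cliquePoly (c' ::ₘ R) b' q' +
      C (((c * q : ℕ) : ℤ) - ((c' * q' : ℕ) : ℤ)) * joinPoly R * X ^ 3 := by
  rw [cliquePoly_cons, cliquePoly_cons, h1, h2, map_sub]
  ring

lemma cliquePoly_add_pair (R : Multiset ℕ) (x y : ℕ) :
    cliquePoly R (x + y) (x * y) = joinPoly (x ::ₘ y ::ₘ R) := by
  simp only [cliquePoly, joinPoly_cons, Nat.cast_add, Nat.cast_mul, map_add, map_mul]
  ring

lemma cliquePoly_coeff_one (R : Multiset ℕ) (b q : ℕ) :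
    (cliquePoly R b q).coeff 1 = ((R.sum + b : ℕ) : ℤ) := by
  rw [cliquePoly, mul_add, mul_add, mul_one, coeff_add, coeff_add, ← mul_assoc, ← mul_assoc,
    coeff_mul_X_pow', coeff_mul_X, coeff_mul_C, joinPoly_coeff_one, joinPoly_coeff_zero]
  simp

lemma cliquePoly_coeff_add_two (R : Multiset ℕ) (b q r : ℕ) :
    (cliquePoly R b q).coeff (r + 2) = (joinPoly R).coeff (r + 2) + (joinPoly R).coeff (r + 1) * b
      + (joinPoly R).coeff r * q := by
  rw [cliquePoly, mul_add, mul_add, mul_one, coeff_add, coeff_add, ← mul_assoc, ← mul_assoc,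
    coeff_mul_X_pow, coeff_mul_X, coeff_mul_C, coeff_mul_C]

lemma two_mul_cliquePoly_coeff_two (R : Multiset ℕ) (b q : ℕ) :
    2 * (cliquePoly R b q).coeff 2 =
      ((R.sum + b : ℕ) : ℤ) ^ 2 - ((R.map fun c => c ^ 2).sum : ℕ) - b ^ 2 + 2 * q := by
  rw [cliquePoly_coeff_add_two, mul_add, mul_add, two_mul_joinPoly_coeff_two, zero_add,
    joinPoly_coeff_one, joinPoly_coeff_zero]
  push_cast; ring

/-! ### Configurations and their reduction to star configurations -/

/-- Part sizes `R`, `b` and an edge number `q ≤ b ^ 2 / 4` that describe graphs with `n` vertices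
and `e` edges. -/
structure IsConfig (n e : ℕ) (R : Multiset ℕ) (b q : ℕ) : Prop where
  pos : ∀ c ∈ R, 1 ≤ c
  mantel : 4 * q ≤ b ^ 2
  sum : R.sum + b = n
  edges : (cliquePoly R b q).coeff 2 = e

/-- All entries of `R` are `x` or `x + 1`, while `1 ≤ y` and `m ≤ x - y`. -/
structure IsStar (R : Multiset ℕ) (x y m : ℕ) : Prop where
  balanced : ∀ c ∈ R, c = x ∨ c = x + 1
  one_le : 1 ≤ y
  le : m + y ≤ x

/-- Take y ≤ b/2 least with q ≤ y(b - y). Minimality says (y - 1)(x + 1) < q, which rearranges to m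
≤ x - y. -/
lemma exists_canonical {b q : ℕ} (h : 4 * q ≤ b ^ 2) :
    ∃ x y m : ℕ, x + y = b ∧ m + y ≤ x ∧ q + m = x * y ∧ (1 ≤ q → 1 ≤ y) := by
  have hex : ∃ y, 2 * y ≤ b ∧ q ≤ y * (b - y) := by
    refine ⟨b / 2, by omega, ?_⟩
    obtain ⟨t, rfl | rfl⟩ := Nat.even_or_odd' b
    · rw [show 2 * t / 2 = t by omega, show 2 * t - t = t by omega]
      nlinarith
    · rw [show (2 * t + 1) / 2 = t by omega, show 2 * t + 1 - t = t + 1 by omega]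
      have : 4 * q ≤ 4 * (t * (t + 1)) + 1 := by nlinarith
      omega
  classical
  obtain ⟨y, ⟨hy1, hy2⟩, hmin⟩ : ∃ y, (2 * y ≤ b ∧ q ≤ y * (b - y)) ∧
      ∀ j < y, ¬ (2 * j ≤ b ∧ q ≤ j * (b - j)) :=
    ⟨Nat.find hex, Nat.find_spec hex, fun j hj => Nat.find_min hex hj⟩
  obtain ⟨x, rfl⟩ : ∃ x, b = x + y := ⟨b - y, by omega⟩
  rw [Nat.add_sub_cancel] at hy2
  refine ⟨x, y, x * y - q, rfl, ?_, by rw [mul_comm] at hy2; omega, ?_⟩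
  · rcases Nat.eq_zero_or_pos y with h0 | h0
    · rw [h0]; simp
    · have h1 := hmin (y - 1) (by omega)
      obtain ⟨z, hz⟩ : ∃ z, y = z + 1 := ⟨y - 1, by omega⟩
      rw [hz] at h1 hy1 hy2 ⊢
      rw [not_and] at h1
      have h2 := h1 (by omega)
      rw [show x + (z + 1) - (z + 1 - 1) = x + 1 by omega, Nat.add_sub_cancel, not_le] at h2
      have h3 : x * (z + 1) + z = z * (x + 1) + x := by ring
      omega
  · intro hq
    by_contra h0
    have : y = 0 := by omega
    rw [this] at hy2
    omega

lemma canonical_lt {x y m q : ℕ} (hy : 1 ≤ y) (hm : m + y ≤ x) (hq : q + m = x * y) : 1 ≤ q := by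
  have : x + y ≤ x * y + 1 := by nlinarith
  omega

/-- Either the part `c` can be merged into the part that carries the triangle-free graph, or its
size can be changed, without creating more triangles. -/
lemma exists_better {c x y m q : ℕ} (hc : 1 ≤ c) (hy : 1 ≤ y) (hm : m + y ≤ x)
    (hq : q + m = x * y) (hx : c ≠ x) (hx' : c ≠ x + 1) :
    4 * (c * (x + y) + q) ≤ (c + (x + y)) ^ 2 ∨
    ∃ c' b' q' : ℕ, 1 ≤ c' ∧ c' + b' = c + (x + y) ∧ c' * b' + q' = c * (x + y) + q ∧
      4 * q' ≤ b' ^ 2 ∧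
      (c' * q' < c * q ∨ (c' * q' = c * q ∧ m = 0 ∧ b' < x + y ∧ c < x)) := by
  -- For any new size c' the required q' is determined, and c'q' - cq = (c' - c)((c' - x)(c' - y) -
  -- m). If q' would be negative, then cb + q < c'b' ≤ (c' + b')²/4, and merging is allowed instead.
  have key : ∀ c' b' : ℕ, 1 ≤ c' → c' + b' = c + (x + y) →
      (c' * b' ≤ c * (x + y) + q → 4 * ((c * (x + y) + q : ℤ) - c' * b') ≤ b' ^ 2) →
      (((c' : ℤ) - c) * ((c' - x) * (c' - y) - m) < 0 ∨
        (((c' : ℤ) - c) * ((c' - x) * (c' - y) - m) = 0 ∧ m = 0 ∧ b' < x + y ∧ c < x)) →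
      4 * (c * (x + y) + q) ≤ (c + (x + y)) ^ 2 ∨
      ∃ c' b' q' : ℕ, 1 ≤ c' ∧ c' + b' = c + (x + y) ∧ c' * b' + q' = c * (x + y) + q ∧
        4 * q' ≤ b' ^ 2 ∧
        (c' * q' < c * q ∨ (c' * q' = c * q ∧ m = 0 ∧ b' < x + y ∧ c < x)) := by
    intro c' b' hc' hsum hman hlt
    by_cases hle : c' * b' ≤ c * (x + y) + q
    · right
      obtain ⟨q', hq'⟩ := Nat.exists_eq_add_of_le hle
      have hq'z : (c' : ℤ) * b' + q' = c * (x + y) + q := by exact_mod_cast hq'.symm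
      have hqz : (q : ℤ) + m = x * y := by exact_mod_cast hq
      have hsz : (b' : ℤ) = c + (x + y) - c' := by
        have : (c' : ℤ) + b' = c + (x + y) := by exact_mod_cast hsum
        linarith
      have hid : (c' : ℤ) * q' - c * q = ((c' : ℤ) - c) * ((c' - x) * (c' - y) - m) := by
        have h1 : (q' : ℤ) = c * (x + y) + q - c' * b' := by linarith
        have h2 : (q : ℤ) = x * y - m := by linarith
        rw [h1, hsz, h2]; ring
      refine ⟨c', b', q', hc', hsum, hq'.symm, ?_, ?_⟩
      · have := hman hle
        zify
        linarith
      · rw [← hid] at hlt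
        rcases hlt with h | ⟨h, h'⟩
        · left; zify; linarith
        · right; refine ⟨?_, h'⟩; zify; linarith
    · left
      rw [← hsum]
      push Not at hle
      zify at hle ⊢
      nlinarith [sq_nonneg ((c' : ℤ) - b')]
  have hqz : (q : ℤ) + m = x * y := by exact_mod_cast hq
  have hmz : (m : ℤ) + y ≤ x := by exact_mod_cast hm
  -- The new size is x if c < y, c + 1 if y ≤ c < x, and c - 1 if c > x + 1. In the last case (c - 1
  -- - x)(c - 1 - y) ≥ x + 1 - y > m, so the drop is strict; ties occur only for c < x and m = 0.
  rcases lt_or_gt_of_ne hx with hlt | hgt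
  · rcases lt_or_ge c y with hcy | hcy
    · refine key x (c + y) (by omega) (by ring) (fun _ => ?_) ?_
      · push_cast
        nlinarith [sq_nonneg ((c : ℤ) - y)]
      · have hxc : (0 : ℤ) < x - c := by zify at hlt; linarith
        rcases Nat.eq_zero_or_pos m with h0 | h0
        · right
          refine ⟨by simp [h0], h0, by omega, hlt⟩
        · left
          have : (0 : ℤ) < m := by exact_mod_cast h0
          nlinarith
    · refine key (c + 1) (x + y - 1) (by omega) (by omega) (fun _ => ?_) ?_
      · obtain ⟨z, rfl⟩ : ∃ z, y = z + 1 := ⟨y - 1, by omega⟩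
        rw [show x + (z + 1) - 1 = x + z by omega]
        push_cast at hqz hmz ⊢
        zify at hlt
        nlinarith [sq_nonneg ((x : ℤ) - z - 2)]
      · have h1 : ((c : ℤ) + 1 - x) ≤ 0 := by zify at hlt; linarith
        have h2 : (0 : ℤ) < c + 1 - y := by zify at hcy; linarith
        have h3 : ((c : ℤ) + 1 - x) * (c + 1 - y) ≤ 0 := mul_nonpos_of_nonpos_of_nonneg h1 h2.le
        push_cast
        rw [show (c : ℤ) + 1 - c = 1 by ring, one_mul]
        rcases Nat.eq_zero_or_pos m with h0 | h0
        · rw [h0]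
          rcases h3.lt_or_eq with h4 | h4
          · left; simpa using h4
          · right; exact ⟨by simpa using h4, rfl, by omega, hlt⟩
        · left
          have : (0 : ℤ) < m := by exact_mod_cast h0
          linarith
  · refine key (c - 1) (x + y + 1) (by omega) (by omega) (fun _ => ?_) (Or.inl ?_)
    · obtain ⟨d, rfl⟩ : ∃ d, c = x + 2 + d := ⟨c - (x + 2), by omega⟩
      rw [show x + 2 + d - 1 = x + 1 + d by omega]
      push_cast
      nlinarith [sq_nonneg ((x : ℤ) - y)]
    · obtain ⟨d, rfl⟩ : ∃ d, c = x + 2 + d := ⟨c - (x + 2), by omega⟩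
      rw [show x + 2 + d - 1 = x + 1 + d by omega]
      push_cast
      have hd : (0 : ℤ) ≤ d := by positivity
      have hyz : (0 : ℤ) ≤ m := by positivity
      nlinarith [mul_nonneg hd hd, mul_nonneg hd (by linarith : (0 : ℤ) ≤ x + 1 - y)]

lemma IsConfig.merge {n e c b q : ℕ} {R : Multiset ℕ} (h : IsConfig n e (c ::ₘ R) b q)
    (hm : 4 * (c * b + q) ≤ (c + b) ^ 2) : IsConfig n e R (c + b) (c * b + q) where
  pos := fun d hd => h.pos d (Multiset.mem_cons_of_mem hd)
  mantel := hm
  sum := by rw [← h.sum, Multiset.sum_cons]; ring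
  edges := by
    rw [← h.edges, cliquePoly_cons, coeff_add, coeff_mul_X_pow', if_neg (by norm_num), add_zero]

lemma IsConfig.swap {n e c b q c' b' q' : ℕ} {R : Multiset ℕ} (h : IsConfig n e (c ::ₘ R) b q)
    (hc' : 1 ≤ c') (h1 : c' + b' = c + b) (h2 : c' * b' + q' = c * b + q)
    (hm : 4 * q' ≤ b' ^ 2) : IsConfig n e (c' ::ₘ R) b' q' where
  pos := fun d hd => by
    rcases Multiset.mem_cons.1 hd with rfl | hd
    · exact hc'
    · exact h.pos d (Multiset.mem_cons_of_mem hd)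
  mantel := hm
  sum := by
    have := h.sum
    rw [Multiset.sum_cons] at this ⊢
    omega
  edges := by
    rw [← h.edges, cliquePoly_cons_swap R h1 h2, coeff_add, coeff_mul_X_pow',
      if_neg (by norm_num), add_zero]

/-- Every configuration can be improved to a star configuration. -/
theorem IsConfig.exists_isStar {n e : ℕ} (he : 1 ≤ e) {R : Multiset ℕ} {b q : ℕ}
    (h : IsConfig n e R b q) :
    ∃ (R' : Multiset ℕ) (x y m q' : ℕ), q' + m = x * y ∧ IsConfig n e R' (x + y) q' ∧
      IsStar R' x y m ∧ ∀ r, (cliquePoly R' (x + y) q').coeff r ≤ (cliquePoly R b q).coeff r := by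
  -- The moves terminate by a lexicographic measure: the number of parts drops in a merge, the
  -- number of triangles in a strict swap, and b in a tied swap.
  suffices H : ∀ (w : ℕ ×ₗ ℕ ×ₗ ℕ) (R : Multiset ℕ) (b q : ℕ), IsConfig n e R b q →
      w = toLex (R.card, toLex (((cliquePoly R b q).coeff 3).toNat, b)) →
      ∃ (R' : Multiset ℕ) (x y m q' : ℕ), q' + m = x * y ∧ IsConfig n e R' (x + y) q' ∧
      IsStar R' x y m ∧ ∀ r, (cliquePoly R' (x + y) q').coeff r ≤ (cliquePoly R b q).coeff r from
    H _ R b q h rfl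
  intro w
  induction w using WellFoundedLT.induction with
  | ind w ih =>
  intro R b q h hw
  have step : ∀ (R' : Multiset ℕ) (b' q' : ℕ), IsConfig n e R' b' q' →
      toLex (R'.card, toLex (((cliquePoly R' b' q').coeff 3).toNat, b')) < w →
      (∀ r, (cliquePoly R' b' q').coeff r ≤ (cliquePoly R b q).coeff r) →
      ∃ (R' : Multiset ℕ) (x y m q' : ℕ), q' + m = x * y ∧ IsConfig n e R' (x + y) q' ∧
      IsStar R' x y m ∧ ∀ r, (cliquePoly R' (x + y) q').coeff r ≤ (cliquePoly R b q).coeff r := by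
    intro R' b' q' h' hlt hle
    obtain ⟨R'', x, y, m, q'', h1, h2, h3, h4⟩ := ih _ hlt R' b' q' h' rfl
    exact ⟨R'', x, y, m, q'', h1, h2, h3, fun r => (h4 r).trans (hle r)⟩
  have merge : ∀ (c : ℕ) (S : Multiset ℕ), R = c ::ₘ S → 4 * (c * b + q) ≤ (c + b) ^ 2 →
      ∃ (R' : Multiset ℕ) (x y m q' : ℕ), q' + m = x * y ∧ IsConfig n e R' (x + y) q' ∧
      IsStar R' x y m ∧ ∀ r, (cliquePoly R' (x + y) q').coeff r ≤ (cliquePoly R b q).coeff r := by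
    intro c S hR hman
    rw [hR] at h
    refine step S _ _ (h.merge hman) ?_ ?_
    · rw [hw, hR, Prod.Lex.toLex_lt_toLex]
      left; simp
    · intro r
      rw [hR, cliquePoly_cons c S b q, coeff_add, coeff_mul_X_pow', coeff_C_mul]
      split_ifs
      · linarith [mul_nonneg (Int.natCast_nonneg (c * q)) (joinPoly_coeff_nonneg S (r - 3))]
      · simp
  obtain ⟨x, y, m, rfl, hmy, hqm, hq⟩ := exists_canonical h.mantel
  -- Without edges in the triangle-free part, any part merges with it by AM-GM, and some part exists
  -- because e ≥ 1.
  rcases Nat.eq_zero_or_pos q with h0 | h0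
  · induction R using Multiset.induction_on with
    | empty =>
      have := h.edges
      rw [cliquePoly_coeff_add_two, h0] at this
      simp [coeff_one] at this
      omega
    | cons c S _ =>
      refine merge c S rfl ?_
      rw [h0]
      nlinarith [sq_nonneg ((c : ℤ) - ((x + y : ℕ) : ℤ)), four_mul_le_sq_add c (x + y)]
  have hy := hq h0
  by_cases hst : ∀ c ∈ R, c = x ∨ c = x + 1
  · exact ⟨R, x, y, m, q, hqm, h, ⟨hst, hy, hmy⟩, fun r => le_rfl⟩
  push Not at hst
  obtain ⟨c, hcR, hcx, hcx'⟩ := hst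
  obtain ⟨S, hS⟩ := Multiset.exists_cons_of_mem hcR
  rcases exists_better (h.pos c hcR) hy hmy hqm hcx hcx' with hman |
    ⟨c', b', q', hc', h1, h2, h3, h4⟩
  · exact merge c S hS hman
  · rw [hS] at h
    have hle : c' * q' ≤ c * q := by
      rcases h4 with h4 | h4
      · exact h4.le
      · exact h4.1.le
    have hlez : (0 : ℤ) ≤ ((c * q : ℕ) : ℤ) - ((c' * q' : ℕ) : ℤ) := by
      rw [sub_nonneg]; exact_mod_cast hle
    refine step (c' ::ₘ S) b' q' (h.swap hc' h1 h2 h3) ?_ ?_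
    · rw [hw, hS, Prod.Lex.toLex_lt_toLex]
      right
      refine ⟨by simp, ?_⟩
      rw [Prod.Lex.toLex_lt_toLex]
      have h5 : (cliquePoly (c ::ₘ S) (x + y) q).coeff 3 = (cliquePoly (c' ::ₘ S) b' q').coeff 3 +
          (((c * q : ℕ) : ℤ) - ((c' * q' : ℕ) : ℤ)) := by
        rw [cliquePoly_cons_swap S h1 h2, coeff_add, coeff_mul_X_pow', if_pos le_rfl, coeff_C_mul,
          Nat.sub_self, joinPoly_coeff_zero, mul_one]
      have h6 : 0 ≤ (cliquePoly (c' ::ₘ S) b' q').coeff 3 := by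
        rw [cliquePoly_coeff_add_two]
        have := joinPoly_coeff_nonneg (c' ::ₘ S)
        have h7 := this 3
        have h8 := mul_nonneg (this 2) (Int.natCast_nonneg b')
        have h9 := mul_nonneg (this 1) (Int.natCast_nonneg q')
        linarith
      rcases h4 with h4 | ⟨h4, -, h5', -⟩
      · left
        have : ((c' * q' : ℕ) : ℤ) < ((c * q : ℕ) : ℤ) := by exact_mod_cast h4
        simp only []
        omega
      · right
        simp only []
        refine ⟨?_, h5'⟩
        rw [h5, h4, sub_self, add_zero]
    · intro r
      rw [hS, cliquePoly_cons_swap S h1 h2, coeff_add, coeff_mul_X_pow', coeff_C_mul]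
      split_ifs
      · linarith [mul_nonneg hlez (joinPoly_coeff_nonneg S (r - 3))]
      · simp

/-- A vertex joined to all others is split off as a part of size 1 until the remaining edges fit
into one triangle-free part. -/
lemma exists_isConfig (n e : ℕ) (hn : 1 ≤ n) (he : e ≤ n.choose 2) :
    ∃ (R : Multiset ℕ) (b q : ℕ), IsConfig n e R b q := by
  induction n, hn using Nat.le_induction generalizing e with
  | base =>
    obtain rfl : e = 0 := by simpa using he
    exact ⟨0, 1, 0, by simp, by simp, by simp, by simp [cliquePoly, coeff_X, coeff_one]⟩
  | succ n hn ih =>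
    rcases le_or_gt e n with h | h
    · refine ⟨0, n + 1, e, by simp, by nlinarith, by simp, ?_⟩
      rw [cliquePoly_coeff_add_two]
      simp [coeff_one]
    · have h1 : (n + 1).choose 2 = n + n.choose 2 := by
        rw [Nat.choose_succ_succ' n 1, Nat.choose_one_right]
      obtain ⟨R, b, q, hR⟩ := ih (e - n) (by omega)
      refine ⟨1 ::ₘ R, b, q, ?_, hR.mantel, ?_, ?_⟩
      · intro c hc
        rcases Multiset.mem_cons.1 hc with rfl | hc
        · exact le_rfl
        · exact hR.pos c hc
      · rw [Multiset.sum_cons, ← hR.sum]; ring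
      · have h2 := hR.edges
        have h3 := cliquePoly_coeff_one R b q
        rw [hR.sum] at h3
        rw [show cliquePoly (1 ::ₘ R) b q = (1 + C (1 : ℤ) * X) * cliquePoly R b q by
          simp [cliquePoly, mul_assoc], coeff_one_add_mul_succ, h2, h3]
        push_cast [h.le]
        ring

/-! ### Turán numbers and sums of squares -/

lemma turanNumber_add (s N : ℕ) :
    turanNumber s (N + s) = turanNumber s N + N * (s - 1) + s.choose 2 :=
  SimpleGraph.card_edgeFinset_turanGraph_add

lemma turanNumber_of_le {s N : ℕ} (h : N ≤ s) : turanNumber s N = N.choose 2 := by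
  have := SimpleGraph.card_edgeFinset_top_eq_card_choose_two (V := Fin N)
  rw [Fintype.card_fin] at this
  unfold turanNumber
  convert! this
  exact SimpleGraph.turanGraph_eq_top.2 (Or.inr h)

lemma two_mul_choose_two (s : ℕ) : 2 * ((s.choose 2 : ℕ) : ℤ) = (s : ℤ) ^ 2 - s := by
  have := Nat.choose_two_right s
  have h2 := (Nat.even_mul_pred_self s).two_dvd
  rcases s with _ | s
  · simp
  · have h3 : 2 * ((s + 1).choose 2) = (s + 1) * s := by
      rw [this, Nat.add_sub_cancel]
      exact Nat.mul_div_cancel' (by simpa using h2)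
    zify at h3
    rw [h3]; push_cast; ring

lemma two_mul_turanNumber (s N : ℕ) (hs : 1 ≤ s) :
    2 * (turanNumber s N : ℤ) =
      (N : ℤ) ^ 2 - (2 * (N / s : ℕ) + 1) * N + s * (N / s : ℕ) * ((N / s : ℕ) + 1) := by
  induction N using Nat.strong_induction_on with
  | _ N ih =>
    by_cases h : N < s
    · rw [turanNumber_of_le h.le, Nat.div_eq_of_lt h, two_mul_choose_two]
      push_cast; ring
    · obtain ⟨M, rfl⟩ : ∃ M, N = M + s := ⟨N - s, by omega⟩
      rw [turanNumber_add, Nat.add_div_right _ hs]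
      have h1 := ih M (by omega)
      have h2 := two_mul_choose_two s
      push_cast [hs] at h1 ⊢
      linear_combination h1 + h2

/-- The right side is N² minus the lower bound for the sum of squares of the parts that comes from
b² ≥ (2z + 1)b - z(z + 1), valid for integers. Equality holds at z = ⌊N/s⌋, by
`two_mul_turanNumber`. -/
lemma two_mul_turanNumber_le (s N : ℕ) (hs : 1 ≤ s) (z : ℤ) :
    2 * (turanNumber s N : ℤ) ≤ (N : ℤ) ^ 2 - (2 * z + 1) * N + s * z * (z + 1) := by
  rw [two_mul_turanNumber s N hs]
  have h1 := Nat.div_add_mod N s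
  have h2 := Nat.mod_lt N hs
  set Y := N / s
  set ρ := N % s
  zify at h1 h2 hs
  have hρ : (0 : ℤ) ≤ ρ := Int.natCast_nonneg _
  have key : 0 ≤ (z - Y) * (s * (z - Y + 1) - 2 * ρ) := by
    rcases lt_trichotomy (z - Y) 0 with h | h | h
    · exact mul_nonneg_of_nonpos_of_nonpos h.le (by nlinarith)
    · simp [h]
    · exact mul_nonneg h.le (by nlinarith)
  rw [← h1]
  linarith

lemma turanNumber_mono {s t : ℕ} (hs : 1 ≤ s) (hst : s ≤ t) (N : ℕ) :
    turanNumber s N ≤ turanNumber t N := by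
  induction t, hst using Nat.le_induction with
  | base => exact le_rfl
  | succ t ht ih =>
    refine ih.trans ?_
    have h1 := two_mul_turanNumber (t + 1) N (by omega)
    have h2 := two_mul_turanNumber_le t N (by omega) (N / (t + 1) : ℕ)
    have h3 : (0 : ℤ) ≤ (N / (t + 1) : ℕ) := Int.natCast_nonneg _
    zify
    push_cast at h1 h2 h3 ⊢
    nlinarith

lemma le_sum_sq (R : Multiset ℕ) (z : ℤ) :
    (2 * z + 1) * (R.sum : ℤ) - R.card * z * (z + 1) ≤ ((R.map fun c => c ^ 2).sum : ℕ) := by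
  induction R using Multiset.induction_on with
  | empty => simp
  | cons c R ih =>
    simp only [Multiset.sum_cons, Multiset.card_cons, Multiset.map_cons]
    push_cast
    have : 0 ≤ ((c : ℤ) - z) * (c - z - 1) := by
      rcases le_or_gt (c : ℤ) z with h | h
      · exact mul_nonneg_of_nonpos_of_nonpos (by linarith) (by linarith)
      · exact mul_nonneg (by linarith) (by linarith [Int.add_one_le_iff.2 h])
    push_cast at ih
    linarith

lemma sum_sq_of_balanced (R : Multiset ℕ) (x : ℕ) (h : ∀ c ∈ R, c = x ∨ c = x + 1) :
    (((R.map fun c => c ^ 2).sum : ℕ) : ℤ) =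
      (2 * x + 1) * (R.sum : ℤ) - R.card * x * (x + 1) := by
  induction R using Multiset.induction_on with
  | empty => simp
  | cons c R ih =>
    have ih' := ih fun d hd => h d (Multiset.mem_cons_of_mem hd)
    simp only [Multiset.sum_cons, Multiset.card_cons, Multiset.map_cons]
    push_cast at ih' ⊢
    rcases h c (Multiset.mem_cons_self c R) with rfl | rfl <;> push_cast <;> linarith

lemma IsConfig.two_mul_edges {n e b q : ℕ} {R : Multiset ℕ} (h : IsConfig n e R b q) :
    2 * (e : ℤ) = (n : ℤ) ^ 2 - ((R.map fun c => c ^ 2).sum : ℕ) - b ^ 2 + 2 * q := by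
  rw [← h.edges, two_mul_cliquePoly_coeff_two, h.sum]

/-- Since q ≤ xy with x + y = b, the edge number is at most that of the complete multipartite graph
with parts x, y and R. -/
lemma IsConfig.le_turanNumber {n e b q : ℕ} {R : Multiset ℕ} (h : IsConfig n e R b q) :
    e ≤ turanNumber (R.card + 2) n := by
  obtain ⟨x, y, m, rfl, -, hq, -⟩ := exists_canonical h.mantel
  have h1 := h.two_mul_edges
  have h2 := two_mul_turanNumber (R.card + 2) n (by omega)
  have h3 := le_sum_sq (x ::ₘ y ::ₘ R) (n / (R.card + 2) : ℕ)
  simp only [Multiset.sum_cons, Multiset.card_cons, Multiset.map_cons] at h3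
  have h4 := h.sum
  rw [show x + (y + R.sum) = n by omega] at h3
  zify at hq
  zify
  push_cast at h1 h2 h3 ⊢
  nlinarith

/-! ### Star configurations are given by the parameters a_i^* -/

lemma exists_replicate_of_balanced (R : Multiset ℕ) (x : ℕ) (h : ∀ c ∈ R, c = x ∨ c = x + 1) :
    ∃ i j : ℕ, R = Multiset.replicate i x + Multiset.replicate j (x + 1) := by
  induction R using Multiset.induction_on with
  | empty => exact ⟨0, 0, by simp⟩
  | cons c R ih =>
    obtain ⟨i, j, hij⟩ := ih fun d hd => h d (Multiset.mem_cons_of_mem hd)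
    rcases h c (Multiset.mem_cons_self c R) with rfl | rfl
    · exact ⟨i + 1, j, by rw [hij, Multiset.replicate_succ, Multiset.cons_add]⟩
    · exact ⟨i, j + 1, by rw [hij, Multiset.replicate_succ, Multiset.add_cons]⟩

lemma eq_of_balanced {R S : Multiset ℕ} {x : ℕ} (hR : ∀ c ∈ R, c = x ∨ c = x + 1)
    (hS : ∀ c ∈ S, c = x ∨ c = x + 1) (hcard : R.card = S.card) (hsum : R.sum = S.sum) :
    R = S := by
  obtain ⟨i, j, rfl⟩ := exists_replicate_of_balanced R x hR
  obtain ⟨i', j', rfl⟩ := exists_replicate_of_balanced S x hS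
  simp only [Multiset.card_add, Multiset.card_replicate, Multiset.sum_add,
    Multiset.sum_replicate, smul_eq_mul] at hcard hsum
  have h1 : (i + j) * x + j = (i' + j') * x + j' := by linarith
  rw [hcard] at h1
  obtain rfl : j = j' := by omega
  obtain rfl : i = i' := by omega
  rfl

lemma joinPoly_map_coeff {ι : Type*} (I : Finset ι) (f : ι → ℕ) (q : ℕ) :
    (joinPoly (I.val.map f)).coeff q = ((∑ J ∈ I.powersetCard q, ∏ i ∈ J, f i : ℕ) : ℤ) := by
  classical
  have h1 : joinPoly (I.val.map f) = ∏ i ∈ I, (1 + C (f i : ℤ) * X) := by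
    rw [joinPoly, Multiset.map_map]; rfl
  have h2 : ∀ J : Finset ι, (∏ i ∈ J, (C (f i : ℤ) * X)).coeff q =
      if J.card = q then ((∏ i ∈ J, f i : ℕ) : ℤ) else 0 := by
    intro J
    rw [Finset.prod_mul_distrib, Finset.prod_const, ← map_prod, coeff_C_mul, coeff_X_pow]
    push_cast
    split_ifs with h3 h4 h4
    · rw [mul_one]
    · exact absurd h3.symm h4
    · exact absurd h4.symm h3
    · rw [mul_zero]
  rw [h1, Finset.prod_one_add, finsetSum_coeff, Finset.sum_congr rfl fun J _ => h2 J,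
    ← Finset.sum_filter, ← Finset.powersetCard_eq_filter, Nat.cast_sum]

lemma starSum_eq (n e s q : ℕ) :
    (starSum n e s q : ℤ) = (joinPoly ((Finset.Icc 1 s).val.map (starPart n e))).coeff q := by
  rw [joinPoly_map_coeff, starSum]

lemma Icc_succ_val_map (s : ℕ) (f : ℕ → ℕ) :
    (Finset.Icc 1 (s + 1)).val.map f = f (s + 1) ::ₘ (Finset.Icc 1 s).val.map f := by
  have : Finset.Icc 1 (s + 1) = Finset.cons (s + 1) (Finset.Icc 1 s) (by simp) := by
    ext i; simp only [Finset.mem_Icc, Finset.mem_cons]; omega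
  rw [this, Finset.cons_val, Multiset.map_cons]

/-- A star configuration is the one that is described by the parameters `a_i^*`. -/
structure IsStarData (n e : ℕ) (R : Multiset ℕ) (x y m q : ℕ) : Prop where
  chromaticParam_eq : chromaticParam n e = R.card + 2
  map_starPart : (Finset.Icc 1 R.card).val.map (starPart n e) = R
  starPart_middle : starPart n e (R.card + 1) = x
  starPart_last : starPart n e (R.card + 2) = y
  mStar_eq : mStar n e = m
  hStar_eq : ∀ r, 2 ≤ r → hStar r n e = (cliquePoly R (x + y) q).coeff r

/-- The complete multipartite graph with parts R, x, y has e + m edges, and removing y leaves a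
balanced graph on N = n - y vertices. As m ≤ x - y, shrinking the last part below y would lose more
than m edges, so y is the least admissible size. -/
theorem IsStar.isStarData {n e : ℕ} {R : Multiset ℕ} {x y m q : ℕ} (hs : IsStar R x y m)
    (h : IsConfig n e R (x + y) q) (hq : q + m = x * y) : IsStarData n e R x y m q := by
  obtain ⟨hbal, hy, hmy⟩ := hs
  obtain ⟨N, hN⟩ : ∃ N, N = R.sum + x := ⟨_, rfl⟩
  have hn : n = N + y := by rw [← h.sum, hN]; ring
  have hsum_lo : ∀ S : Multiset ℕ, (∀ c ∈ S, c = x ∨ c = x + 1) →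
      S.card * x ≤ S.sum ∧ S.sum ≤ S.card * x + S.card := by
    intro S hS
    obtain ⟨i, j, rfl⟩ := exists_replicate_of_balanced S x hS
    simp only [Multiset.card_add, Multiset.card_replicate, Multiset.sum_add,
      Multiset.sum_replicate, smul_eq_mul]
    constructor <;> nlinarith
  -- The entry x itself keeps the sum below (|R| + 1)(x + 1).
  have hdiv : N / (R.card + 1) = x := by
    obtain ⟨h1, h2⟩ := hsum_lo R hbal
    rw [hN]
    exact Nat.div_eq_of_lt_le (by linarith) (by linarith)
  have hsq := sum_sq_of_balanced R x hbal
  have he := h.two_mul_edges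
  have hqz : (q : ℤ) + m = x * y := by exact_mod_cast hq
  have hmz : (m : ℤ) + y ≤ x := by exact_mod_cast hmy
  have htur := two_mul_turanNumber (R.card + 1) N (by omega)
  rw [hdiv] at htur
  have hNz : (N : ℤ) = R.sum + x := by rw [hN]; push_cast; ring
  have hnz : (n : ℤ) = N + y := by rw [hn]; push_cast; ring
  have hg : (e : ℤ) + m = y * N + turanNumber (R.card + 1) N := by
    have : 2 * ((e : ℤ) + m) = 2 * (y * N + turanNumber (R.card + 1) N) := by
      rw [mul_add, mul_add, he, htur, hsq, hnz, hNz]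
      push_cast
      linear_combination 2 * hqz
    linarith
  -- The bound `two_mul_turanNumber_le` with z = x is exact at N. It gives a loss of at least (y -
  -- a)(x - y + 1) + (y - a)(y - a - 1)/2 > m from the value e + m at y. The case a = 0 is
  -- t_{k-1}(n) < e and identifies k.
  have hlt : ∀ a < y, a * (n - a) + turanNumber (R.card + 1) (n - a) < e := by
    intro a ha
    have h1 := two_mul_turanNumber_le (R.card + 1) (n - a) (by omega) x
    have han : ((n - a : ℕ) : ℤ) = N + y - a := by
      rw [Nat.cast_sub (by omega), hnz]
    zify
    rw [han] at h1 ⊢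
    have h2 : (1 : ℤ) ≤ y - a := by zify at ha; linarith
    have h3 : (m : ℤ) < (y - a) * (x - y + 1) := by nlinarith
    have h5 : (0 : ℤ) ≤ (y - a) * (y - a - 1) := mul_nonneg (by linarith) (by linarith)
    push_cast at h1 htur
    linarith
  have hk : chromaticParam n e = R.card + 2 := by
    refine IsLeast.csInf_eq ⟨⟨by omega, h.le_turanNumber⟩, ?_⟩
    rintro s ⟨hs1, hs2⟩
    by_contra hcon
    have h1 := turanNumber_mono hs1 (show s ≤ R.card + 1 by omega) n
    have h2 := hlt 0 (by omega)
    simp only [zero_mul, zero_add, Nat.sub_zero] at h2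
    omega
  have ha : smallestPart n e = y := by
    unfold smallestPart
    rw [hk, show R.card + 2 - 1 = R.card + 1 by omega]
    refine IsLeast.csInf_eq ⟨⟨hy, ?_⟩, ?_⟩
    · rw [hn, Nat.add_sub_cancel]
      zify
      linarith
    · rintro a ⟨-, ha2⟩
      by_contra hcon
      have := hlt a (by omega)
      omega
  have hpart : ∀ i, i ≠ R.card + 2 → starPart n e i = balancedPart N (R.card + 1) i := by
    intro i hi
    rw [starPart, if_neg (by rw [hk]; exact hi), ha, hk, hn, Nat.add_sub_cancel]
    rfl
  have hmid : balancedPart N (R.card + 1) (R.card + 1) = x := by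
    rw [balancedPart, Nat.add_sub_cancel, hdiv]
  have hlast : starPart n e (R.card + 2) = y := by
    rw [starPart, if_pos hk.symm, ha]
  have hmap : (Finset.Icc 1 R.card).val.map (starPart n e) = R := by
    have h1 : (Finset.Icc 1 R.card).val.map (starPart n e) =
        (Finset.Icc 1 R.card).val.map (balancedPart N (R.card + 1)) := by
      refine Multiset.map_congr rfl fun i hi => hpart i ?_
      have := (Finset.mem_Icc.1 (Finset.mem_def.2 hi)).2
      omega
    rw [h1]
    refine eq_of_balanced (x := x) ?_ hbal (by simp) ?_
    · intro c hc
      obtain ⟨i, hi, rfl⟩ := Multiset.mem_map.1 hc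
      obtain ⟨hi1, hi2⟩ := Finset.mem_Icc.1 (Finset.mem_def.2 hi)
      have h2 := balancedPart_antitone N (R.card + 1) hi1
      have h3 := balancedPart_antitone N (R.card + 1) (show i ≤ R.card + 1 by omega)
      have h4 := balancedPart_one_le N (R.card + 1) (by omega)
      omega
    · have h2 := sum_balancedPart N (R.card + 1) (by omega)
      rw [← Finset.sum_map_val, Icc_succ_val_map, Multiset.sum_cons, hmid] at h2
      omega
  have hmid' : starPart n e (R.card + 1) = x := by
    rw [hpart _ (by omega), hmid]
  have hall : joinPoly ((Finset.Icc 1 (R.card + 2)).val.map (starPart n e)) =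
      cliquePoly R (x + y) (x * y) := by
    rw [Icc_succ_val_map, Icc_succ_val_map, hmap, hmid', hlast, cliquePoly_add_pair,
      Multiset.cons_swap]
  have hm : mStar n e = m := by
    rw [mStar, starSum_eq, hk, hall, ← h.edges, cliquePoly_coeff_add_two, cliquePoly_coeff_add_two,
      joinPoly_coeff_zero]
    push_cast
    linarith
  refine ⟨hk, hmap, hmid', hlast, hm, fun r hr => ?_⟩
  obtain ⟨t, rfl⟩ : ∃ t, r = t + 2 := ⟨r - 2, by omega⟩
  rw [hStar, hm, starSum_eq, starSum_eq, hk, hall, Nat.add_sub_cancel, Nat.add_sub_cancel, hmap,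
    cliquePoly_coeff_add_two, cliquePoly_coeff_add_two]
  push_cast
  linear_combination (joinPoly R).coeff t * (-hqz)

theorem exists_isStarData (n e : ℕ) (hn : 1 ≤ n) (he : 1 ≤ e) (hen : e ≤ n.choose 2) :
    ∃ (R : Multiset ℕ) (x y m q : ℕ), IsStar R x y m ∧ IsConfig n e R (x + y) q ∧
      q + m = x * y ∧ IsStarData n e R x y m q := by
  obtain ⟨R, b, q, h⟩ := exists_isConfig n e hn hen
  obtain ⟨R', x, y, m, q', h1, h2, h3, -⟩ := h.exists_isStar he
  exact ⟨R', x, y, m, q', h3, h2, h1, h3.isStarData h2 h1⟩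

theorem IsConfig.hStar_le {n e r : ℕ} (he : 1 ≤ e) (hr : 2 ≤ r) {R : Multiset ℕ} {b q : ℕ}
    (h : IsConfig n e R b q) : hStar r n e ≤ (cliquePoly R b q).coeff r := by
  obtain ⟨R', x, y, m, q', h1, h2, h3, h4⟩ := h.exists_isStar he
  rw [(h3.isStarData h2 h1).hStar_eq r hr]
  exact h4 r

/-! ### Counting cliques in joins -/

/-- The `r`-cliques of `G` that are contained in `W`. -/
def cliquesIn {V : Type*} (G : SimpleGraph V) (W : Set V) (r : ℕ) : Set (Finset V) :=
  {s | (s : Set V) ⊆ W ∧ G.IsNClique r s}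

section Count
variable {V : Type*} (G : SimpleGraph V)

lemma ncard_edgeSet_eq : G.edgeSet.ncard = (G.cliqueSet 2).ncard := by
  classical
  have h : G.cliqueSet 2 = Sym2.toFinset '' G.edgeSet := by
    ext s
    rw [SimpleGraph.mem_cliqueSet_iff, Set.mem_image]
    constructor
    · intro hs
      obtain ⟨a, b, hne, rfl⟩ := Finset.card_eq_two.1 hs.card_eq
      have hab : G.Adj a b := hs.isClique (by simp) (by simp) hne
      exact ⟨s(a, b), hab, Sym2.toFinset_mk_eq⟩
    · rintro ⟨z, hz, rfl⟩
      induction z with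
      | _ a b =>
        rw [SimpleGraph.mem_edgeSet] at hz
        rw [Sym2.toFinset_mk_eq, SimpleGraph.isNClique_iff, Finset.card_pair hz.ne]
        refine ⟨?_, rfl⟩
        rw [Finset.coe_pair]
        exact SimpleGraph.isClique_pair.2 fun _ => hz
  rw [h, Set.ncard_image_of_injective]
  intro z w hzw
  ext x
  rw [← Sym2.mem_toFinset, hzw, Sym2.mem_toFinset]

lemma ncard_cliquesIn_eq (W : Set V) (r : ℕ) :
    (cliquesIn G W r).ncard = ((G.induce W).cliqueSet r).ncard := by
  classical
  have h : cliquesIn G W r =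
      Finset.map (Function.Embedding.subtype (· ∈ W)) '' ((G.induce W).cliqueSet r) := by
    ext s
    simp only [cliquesIn, Set.mem_ofPred_eq, Set.mem_image, SimpleGraph.mem_cliqueSet_iff]
    constructor
    · rintro ⟨hs, hcl⟩
      have hmap : (s.subtype (· ∈ W)).map (Function.Embedding.subtype (· ∈ W)) = s :=
        Finset.subtype_map_of_mem fun x hx => hs hx
      refine ⟨s.subtype (· ∈ W), ⟨?_, ?_⟩, hmap⟩
      · intro a ha b hb hab
        exact hcl.isClique (by simpa using ha) (by simpa using hb)
          (by simpa [Subtype.ext_iff] using hab)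
      · rw [← hcl.card_eq, ← Finset.card_map (Function.Embedding.subtype (· ∈ W)), hmap]
    · rintro ⟨t, ht, rfl⟩
      refine ⟨?_, ?_, ?_⟩
      · intro x hx
        simp only [Finset.coe_map, Set.mem_image] at hx
        obtain ⟨y, -, rfl⟩ := hx
        exact y.2
      · intro a ha b hb hab
        simp only [Finset.coe_map, Set.mem_image] at ha hb
        obtain ⟨a', ha', rfl⟩ := ha
        obtain ⟨b', hb', rfl⟩ := hb
        exact ht.isClique ha' hb' (fun h => hab (by rw [h]))
      · rw [Finset.card_map, ht.card_eq]
  rw [h, Set.ncard_image_of_injective _ (Finset.map_injective _)]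

lemma cliquesIn_univ (r : ℕ) : cliquesIn G Set.univ r = G.cliqueSet r := by
  ext s; simp [cliquesIn]

lemma ncard_cliquesIn_zero (W : Set V) : (cliquesIn G W 0).ncard = 1 := by
  rw [ncard_cliquesIn_eq, SimpleGraph.cliqueSet_zero, Set.ncard_singleton]

lemma ncard_cliquesIn_of_cliqueFree {S : Set V} (h : (G.induce S).CliqueFree 3) (r : ℕ) :
    ((cliquesIn G S r).ncard : ℤ) =
      (cliquePoly 0 S.ncard (G.induce S).edgeSet.ncard).coeff r := by
  match r with
  | 0 => rw [ncard_cliquesIn_zero]; simp [cliquePoly]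
  | 1 =>
    rw [cliquePoly_coeff_one, ncard_cliquesIn_eq, SimpleGraph.cliqueSet_one,
      ← Set.image_univ, Set.ncard_image_of_injective _ Finset.singleton_injective, Set.ncard_univ]
    simp [Nat.card_coe_set_eq]
  | 2 =>
    rw [cliquePoly_coeff_add_two, ncard_edgeSet_eq, ncard_cliquesIn_eq]
    simp [coeff_one]
  | r + 3 =>
    rw [cliquePoly_coeff_add_two, ncard_cliquesIn_eq,
      (h.mono (by omega)).cliqueSet]
    simp [coeff_one]

variable [Finite V]

/-- `A` is independent, so a clique contains at most one of its vertices, and any such vertex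
extends every clique of `W`. -/
lemma ncard_cliquesIn_union {A W : Set V} (hdisj : Disjoint A W)
    (hA : ∀ a ∈ A, ∀ b ∈ A, ¬ G.Adj a b) (hAW : ∀ a ∈ A, ∀ w ∈ W, G.Adj a w) (r : ℕ) :
    (cliquesIn G (A ∪ W) (r + 1)).ncard =
      (cliquesIn G W (r + 1)).ncard + A.ncard * (cliquesIn G W r).ncard := by
  classical
  have hnot : ∀ a ∈ A, a ∉ W := fun a ha hw => Set.disjoint_left.1 hdisj ha hw
  have h : cliquesIn G (A ∪ W) (r + 1) = cliquesIn G W (r + 1) ∪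
      (fun p : V × Finset V => insert p.1 p.2) '' (A ×ˢ cliquesIn G W r) := by
    ext s
    constructor
    · rintro ⟨hs, hcl⟩
      by_cases hW : (s : Set V) ⊆ W
      · exact Or.inl ⟨hW, hcl⟩
      · right
        obtain ⟨a, has, haW⟩ := Set.not_subset.1 hW
        have haA : a ∈ A := (hs has).resolve_right haW
        refine ⟨(a, s.erase a), ⟨haA, ?_, ?_, ?_⟩, Finset.insert_erase has⟩
        · intro b hb
          rw [Finset.coe_erase, Set.mem_sdiff, Set.mem_singleton_iff] at hb
          refine (hs hb.1).resolve_left fun hbA => ?_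
          exact hA b hbA a haA (hcl.isClique hb.1 has hb.2)
        · exact hcl.isClique.subset (by simp)
        · rw [Finset.card_erase_of_mem has, hcl.card_eq, Nat.add_sub_cancel]
    · rintro (⟨hs, hcl⟩ | ⟨⟨a, t⟩, ⟨ha, ht, hcl⟩, rfl⟩)
      · exact ⟨hs.trans Set.subset_union_right, hcl⟩
      · refine ⟨?_, hcl.insert fun b hb => hAW a ha b (ht hb)⟩
        rw [Finset.coe_insert]
        exact Set.insert_subset (Or.inl ha) (ht.trans Set.subset_union_right)
  rw [h, Set.ncard_union_eq, Set.InjOn.ncard_image, Set.ncard_prod]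
  · rintro ⟨a, t⟩ ⟨ha, ht, -⟩ ⟨b, u⟩ ⟨hb, hu, -⟩ hab
    simp only at ha ht hb hu hab
    have hau : a ∉ u := fun h' => hnot a ha (hu h')
    have hbt : b ∉ t := fun h' => hnot b hb (ht h')
    have hat : a ∉ t := fun h' => hnot a ha (ht h')
    have hbu : b ∉ u := fun h' => hnot b hb (hu h')
    have h1 : a = b := by
      have : a ∈ insert b u := hab ▸ Finset.mem_insert_self a t
      exact (Finset.mem_insert.1 this).resolve_right hau
    subst h1
    rw [← Finset.erase_insert hat, hab, Finset.erase_insert hau]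
  · rw [Set.disjoint_left]
    rintro _ ⟨hs, -⟩ ⟨⟨a, t⟩, ⟨ha, -⟩, rfl⟩
    exact hnot a ha (hs (by simp))

/-- Starting from `S`, adding the colour classes in `Q` one at a time multiplies the clique
polynomial by a factor 1 + |A|X each. Colours outside `Q` play no role inside `S`. -/
theorem cliqueSet_ncard {ι : Type*} (c : V → ι) (Q : Finset ι) (S : Set V)
    (hS : ∀ v, v ∈ S ↔ c v ∉ Q) (hfree : (G.induce S).CliqueFree 3)
    (hG : ∀ u v, ¬ (u ∈ S ∧ v ∈ S) → (G.Adj u v ↔ (multipartite c).Adj u v)) (r : ℕ) :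
    ((G.cliqueSet r).ncard : ℤ) =
      (cliquePoly (Q.val.map fun i => (c ⁻¹' {i}).ncard) S.ncard
        (G.induce S).edgeSet.ncard).coeff r := by
  classical
  have key : ∀ Q' ⊆ Q, ∀ r, ((cliquesIn G (S ∪ c ⁻¹' (Q' : Set ι)) r).ncard : ℤ) =
      (cliquePoly (Q'.val.map fun i => (c ⁻¹' {i}).ncard) S.ncard
        (G.induce S).edgeSet.ncard).coeff r := by
    intro Q'
    induction Q' using Finset.induction_on with
    | empty =>
      intro _ r
      rw [Finset.coe_empty, Set.preimage_empty, Set.union_empty,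
        ncard_cliquesIn_of_cliqueFree G hfree]
      rfl
    | insert i Q' hi ih =>
      intro hQ r
      have hQ' : Q' ⊆ Q := (Finset.subset_insert i Q').trans hQ
      have hiQ : i ∈ Q := hQ (Finset.mem_insert_self i Q')
      have hiS : ∀ v, c v = i → v ∉ S := fun v hv hvS => (hS v).1 hvS (hv ▸ hiQ)
      have hset : S ∪ c ⁻¹' ((insert i Q' : Finset ι) : Set ι) =
          c ⁻¹' {i} ∪ (S ∪ c ⁻¹' (Q' : Set ι)) := by
        ext v; simp; tauto
      have hpoly : cliquePoly ((insert i Q').val.map fun i => (c ⁻¹' {i}).ncard) S.ncard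
          (G.induce S).edgeSet.ncard = (1 + C ((c ⁻¹' {i}).ncard : ℤ) * X) *
          cliquePoly (Q'.val.map fun i => (c ⁻¹' {i}).ncard) S.ncard
          (G.induce S).edgeSet.ncard := by
        rw [Finset.insert_val_of_notMem hi, Multiset.map_cons, cliquePoly, joinPoly_cons, mul_assoc,
          cliquePoly]
      rw [hset, hpoly]
      cases r with
      | zero => rw [ncard_cliquesIn_zero, coeff_one_add_mul_zero, ← ih hQ', ncard_cliquesIn_zero]
      | succ r =>
        rw [ncard_cliquesIn_union, coeff_one_add_mul_succ, ← ih hQ', ← ih hQ']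
        · push_cast; ring
        · rw [Set.disjoint_left]
          rintro v hv (hvS | hvQ)
          · exact hiS v hv hvS
          · have hv' : c v = i := hv
            exact hi (by rw [← hv']; exact hvQ)
        · intro a ha b hb hab
          rw [hG a b fun h => hiS a ha h.1] at hab
          have ha' : c a = i := ha
          have hb' : c b = i := hb
          exact hab (ha'.trans hb'.symm)
        · intro a ha w hw
          rw [hG a w fun h => hiS a ha h.1]
          have ha' : c a = i := ha
          intro haw
          replace haw : c a = c w := haw
          rcases hw with hw | hw
          · exact hiS w (haw.symm.trans ha') hw
          · exact hi (by rw [← ha', haw]; exact hw)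
  have huniv : S ∪ c ⁻¹' (Q : Set ι) = Set.univ := by
    ext v
    simp only [Set.mem_union, hS, Set.mem_preimage, Finset.mem_coe, Set.mem_univ, iff_true]
    tauto
  rw [← key Q subset_rfl r, huniv, cliquesIn_univ]

end Count

/-! ### Configurations that attain the minimum -/

lemma exists_cons_min (D : Multiset ℕ) (hD : D ≠ 0) :
    ∃ a R, D = a ::ₘ R ∧ ∀ c ∈ R, a ≤ c := by
  obtain ⟨a, ha, hmin⟩ := D.toFinset.exists_min_image id (by
    rwa [Multiset.toFinset_nonempty])
  obtain ⟨R, rfl⟩ := Multiset.exists_cons_of_mem (Multiset.mem_toFinset.1 ha)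
  exact ⟨a, R, rfl, fun c hc => hmin c (Multiset.mem_toFinset.2 (Multiset.mem_cons_of_mem hc))⟩

lemma exists_cons_cons_min (D : Multiset ℕ) (hD : 2 ≤ D.card) :
    ∃ x y R, D = x ::ₘ y ::ₘ R ∧ y ≤ x ∧ ∀ c ∈ R, x ≤ c := by
  obtain ⟨y, D', rfl, hy⟩ := exists_cons_min D (by rintro rfl; simp at hD)
  obtain ⟨x, R, rfl, hx⟩ := exists_cons_min D' (by rintro rfl; simp at hD)
  exact ⟨x, y, R, Multiset.cons_swap _ _ _, hy x (Multiset.mem_cons_self _ _), hx⟩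

/-- A configuration with the minimum number of cliques is a star configuration, provided that its
parts are sorted or that its triangle-free part has no representation as a complete bipartite
graph. -/
lemma IsConfig.isStar_of_coeff_eq {n e r x y m q : ℕ} (he : 1 ≤ e) {R : Multiset ℕ}
    (h : IsConfig n e R (x + y) q) (hr : 3 ≤ r) (hR : r ≤ R.card + 2) (hq : q + m = x * y)
    (hy : 1 ≤ y) (hm : m + y ≤ x) (hmx : 1 ≤ m ∨ ∀ c ∈ R, x ≤ c)
    (heq : (cliquePoly R (x + y) q).coeff r = hStar r n e) : IsStar R x y m := by
  refine ⟨fun c hc => ?_, hy, hm⟩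
  by_contra hcon
  push Not at hcon
  obtain ⟨S, rfl⟩ := Multiset.exists_cons_of_mem hc
  -- With at least r - 3 other parts, this factor is positive, so lowering cq strictly lowers the
  -- number of r-cliques below the minimum.
  have hpos : 0 < (joinPoly S).coeff (r - 3) := by
    refine joinPoly_coeff_pos S (fun d hd => h.pos d (Multiset.mem_cons_of_mem hd)) _ ?_
    rw [Multiset.card_cons] at hR
    omega
  have hc1 := h.pos c hc
  have hq1 := canonical_lt hy hm hq
  rcases exists_better hc1 hy hm hq hcon.1 hcon.2 with hman | ⟨c', b', q', hc', h1, h2, h3, h4⟩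
  · have h5 := (h.merge hman).hStar_le he (show 2 ≤ r by omega)
    rw [← heq, cliquePoly_cons c S, coeff_add, coeff_mul_X_pow', if_pos hr, coeff_C_mul] at h5
    have h6 : (0 : ℤ) < ((c * q : ℕ) : ℤ) := by
      have : 0 < c * q := Nat.mul_pos hc1 hq1
      exact_mod_cast this
    linarith [mul_pos h6 hpos]
  -- A tie would need m = 0 and c < x, which `hmx` excludes.
  · have hlt : c' * q' < c * q := by
      rcases h4 with h4 | ⟨-, h5, -, h6⟩
      · exact h4
      · rcases hmx with h7 | h7
        · omega
        · have := h7 c hc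
          omega
    have h5 := (h.swap hc' h1 h2 h3).hStar_le he (show 2 ≤ r by omega)
    rw [← heq, cliquePoly_cons_swap S h1 h2, coeff_add, coeff_mul_X_pow', if_pos hr,
      coeff_C_mul] at h5
    have h6 : (0 : ℤ) < ((c * q : ℕ) : ℤ) - ((c' * q' : ℕ) : ℤ) := by
      rw [sub_pos]; exact_mod_cast hlt
    linarith [mul_pos h6 hpos]

/-- When q = xy the polynomial is a product over the multiset x, y, R, so any two of its entries may
serve as the distinguished pair. -/
lemma isConfig_of_pair {n e x y x' y' : ℕ} {R R' : Multiset ℕ}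
    (h : IsConfig n e R (x + y) (x * y)) (hx : 1 ≤ x) (hy : 1 ≤ y)
    (hD : x ::ₘ y ::ₘ R = x' ::ₘ y' ::ₘ R') : IsConfig n e R' (x' + y') (x' * y') where
  pos := fun c hc => by
    have : c ∈ x ::ₘ y ::ₘ R := by
      rw [hD]; exact Multiset.mem_cons_of_mem (Multiset.mem_cons_of_mem hc)
    rcases Multiset.mem_cons.1 this with rfl | this
    · exact hx
    rcases Multiset.mem_cons.1 this with rfl | this
    · exact hy
    · exact h.pos c this
  mantel := by nlinarith [four_mul_le_sq_add x' y']
  sum := by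
    have h1 := congrArg Multiset.sum hD
    have h2 := h.sum
    simp only [Multiset.sum_cons] at h1
    omega
  edges := by rw [← h.edges, cliquePoly_add_pair, cliquePoly_add_pair, hD]

/-! ### The replacements allowed in ℋ₁^* -/

/-- `R_i`: the multiset of the parts `a_j^*` with `j < k` and `j ≠ i`. -/
noncomputable def otherParts (n e i : ℕ) : Multiset ℕ :=
  ((Finset.Icc 1 (chromaticParam n e - 1)).erase i).val.map (starPart n e)

namespace IsStarData
variable {n e x y m q : ℕ} {R : Multiset ℕ} (hd : IsStarData n e R x y m q)
include hd

lemma map_eq : (Finset.Icc 1 (chromaticParam n e - 1)).val.map (starPart n e) = x ::ₘ R := by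
  rw [hd.chromaticParam_eq, show R.card + 2 - 1 = R.card + 1 by omega, Icc_succ_val_map,
    hd.map_starPart, hd.starPart_middle]

lemma cons_otherParts {i : ℕ} (hi : i ∈ Finset.Icc 1 (chromaticParam n e - 1)) :
    starPart n e i ::ₘ otherParts n e i = x ::ₘ R := by
  rw [← hd.map_eq, otherParts, ← Multiset.map_cons, ← Finset.insert_val_of_notMem
    (Finset.notMem_erase _ _), Finset.insert_erase hi]

lemma last_mem : R.card + 1 ∈ Finset.Icc 1 (chromaticParam n e - 1) := by
  rw [hd.chromaticParam_eq, Finset.mem_Icc]; omega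

lemma otherParts_last : otherParts n e (R.card + 1) = R := by
  have := hd.cons_otherParts hd.last_mem
  rwa [hd.starPart_middle, Multiset.cons_inj_right] at this

end IsStarData

/-- The condition on the replaced pair of parts and on the number of edges in the definition of
`familyHOneStar`. -/
def IsReplacementParam (n e i : ℕ) (q : ℤ) : Prop :=
  (mStar n e = 0 ∧ i ∈ Finset.Icc 1 (chromaticParam n e - 1) ∧
    q = (starPart n e i : ℤ) * starPart n e (chromaticParam n e)) ∨
  (0 < mStar n e ∧ i = chromaticParam n e - 1 ∧
    q = (starPart n e (chromaticParam n e - 1) : ℤ) * starPart n e (chromaticParam n e)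
            - mStar n e)

lemma mem_familyHOneStar {n e : ℕ} {G : SimpleGraph (Fin n)} :
    G ∈ familyHOneStar n e ↔ ∃ (c : Fin n → ℕ) (i : ℕ) (q : ℤ),
      (∀ v, c v ∈ Finset.Icc 1 (chromaticParam n e)) ∧
      (∀ j ∈ Finset.Icc 1 (chromaticParam n e), (c ⁻¹' {j}).ncard = starPart n e j) ∧
      IsReplacementParam n e i q ∧
      IsTriangleFreeReplacement (multipartite c) (c ⁻¹' {i, chromaticParam n e}) q G := by
  constructor
  · rintro ⟨c, h1, h2, ⟨h3, i, hi, h4⟩ | ⟨h3, h4⟩⟩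
    · exact ⟨c, i, _, h1, h2, Or.inl ⟨h3, hi, rfl⟩, h4⟩
    · exact ⟨c, _, _, h1, h2, Or.inr ⟨h3, rfl, rfl⟩, h4⟩
  · rintro ⟨c, i, q, h1, h2, ⟨h3, hi, rfl⟩ | ⟨h3, rfl, rfl⟩, h4⟩
    · exact ⟨c, h1, h2, Or.inl ⟨h3, i, hi, h4⟩⟩
    · exact ⟨c, h1, h2, Or.inr ⟨h3, h4⟩⟩

namespace IsStarData
variable {n e x y m q : ℕ} {R : Multiset ℕ} (hd : IsStarData n e R x y m q)
include hd

lemma isReplacementParam_last (hq : q + m = x * y) :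
    IsReplacementParam n e (R.card + 1) q := by
  have hqz : (q : ℤ) + m = x * y := by exact_mod_cast hq
  have hk : chromaticParam n e - 1 = R.card + 1 := by rw [hd.chromaticParam_eq]; omega
  rcases Nat.eq_zero_or_pos m with h0 | h0
  · refine Or.inl ⟨by rw [hd.mStar_eq, h0]; rfl, hd.last_mem, ?_⟩
    rw [hd.chromaticParam_eq, hd.starPart_middle, hd.starPart_last, ← hqz, h0]; simp
  · refine Or.inr ⟨by rw [hd.mStar_eq]; exact_mod_cast h0, hk.symm, ?_⟩
    rw [hk, hd.chromaticParam_eq, hd.starPart_middle, hd.starPart_last, ← hqz, hd.mStar_eq]; simp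

lemma mem_of_isReplacementParam {i : ℕ} {q' : ℤ} (h : IsReplacementParam n e i q') :
    i ∈ Finset.Icc 1 (chromaticParam n e - 1) := by
  rcases h with ⟨-, h, -⟩ | ⟨-, rfl, -⟩
  · exact h
  · rw [hd.chromaticParam_eq, Finset.mem_Icc]; omega

/-- If m^* = 0, every choice of i gives the clique polynomial of the complete multipartite graph T
itself; if m^* > 0, only i = k - 1 occurs. -/
lemma cliquePoly_otherParts (hq : q + m = x * y) {i q' : ℕ} (h : IsReplacementParam n e i q') :
    cliquePoly (otherParts n e i) (starPart n e i + starPart n e (chromaticParam n e)) q' =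
      cliquePoly R (x + y) q := by
  have hi := hd.mem_of_isReplacementParam h
  have hy : starPart n e (chromaticParam n e) = y := by
    rw [hd.chromaticParam_eq, hd.starPart_last]
  have hk : chromaticParam n e - 1 = R.card + 1 := by rw [hd.chromaticParam_eq]; omega
  rw [IsReplacementParam, hy, hd.mStar_eq] at h
  rw [hy]
  rcases h with ⟨h0, -, h1⟩ | ⟨h0, rfl, h1⟩
  · have hm : m = 0 := by exact_mod_cast h0
    have hq' : q' = starPart n e i * y := by exact_mod_cast h1
    rw [hq', cliquePoly_add_pair, Multiset.cons_swap, hd.cons_otherParts hi,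
      Multiset.cons_swap, ← cliquePoly_add_pair, ← hq, hm, add_zero]
  · rw [hk, hd.starPart_middle] at h1
    rw [hk, hd.otherParts_last, hd.starPart_middle]
    have : q' = q := by
      zify
      zify at hq
      linarith
    rw [this]

end IsStarData

/-! ### From configurations to graphs and back -/

lemma ncard_cliqueSet_one {V : Type*} (G : SimpleGraph V) :
    (G.cliqueSet 1).ncard = Nat.card V := by
  rw [SimpleGraph.cliqueSet_one, ← Set.image_univ,
    Set.ncard_image_of_injective _ Finset.singleton_injective, Set.ncard_univ]

lemma four_mul_ncard_edgeSet_le {V : Type*} [Finite V] (G : SimpleGraph V)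
    (hG : G.CliqueFree 3) : 4 * G.edgeSet.ncard ≤ Nat.card V ^ 2 := by
  classical
  have := Fintype.ofFinite V
  have h := SimpleGraph.CliqueFree.card_edgeFinset_le (r := 2) hG
  rw [← SimpleGraph.coe_edgeFinset, Set.ncard_coe_finset, Nat.card_eq_fintype_card]
  simp only at h
  have h1 : (Fintype.card V % 2).choose 2 = 0 :=
    Nat.choose_eq_zero_of_lt (Nat.mod_lt _ (by norm_num))
  rw [h1] at h
  omega

/-- The vertices outside `S` are coloured by `c` with the colours in `Q`, all of which occur, and
`G` is obtained from the complete multipartite graph with parts `S` and the colour classes by adding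
a triangle-free graph into `S`. -/
structure IsRep {V ι : Type*} (G : SimpleGraph V) (c : V → ι) (Q : Finset ι) (S : Set V) :
    Prop where
  mem_iff : ∀ v, v ∈ S ↔ c v ∉ Q
  cliqueFree : (G.induce S).CliqueFree 3
  adj_iff : ∀ u v, ¬ (u ∈ S ∧ v ∈ S) → (G.Adj u v ↔ c u ≠ c v)
  exists_color : ∀ i ∈ Q, ∃ v, c v = i

/-- The sizes of the colour classes with colours in `Q`. -/
noncomputable def classSizes {V ι : Type*} (c : V → ι) (Q : Finset ι) : Multiset ℕ :=
  Q.val.map fun i => (c ⁻¹' {i}).ncard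

namespace IsRep
variable {V ι : Type*} [Finite V] {G : SimpleGraph V} {c : V → ι} {Q : Finset ι} {S : Set V}

lemma ncard_cliqueSet (h : IsRep G c Q S) (r : ℕ) :
    ((G.cliqueSet r).ncard : ℤ) =
      (cliquePoly (classSizes c Q) S.ncard (G.induce S).edgeSet.ncard).coeff r :=
  cliqueSet_ncard G c Q S h.mem_iff h.cliqueFree h.adj_iff r

lemma isConfig (h : IsRep G c Q S) :
    IsConfig (Nat.card V) G.edgeSet.ncard (classSizes c Q) S.ncard
      (G.induce S).edgeSet.ncard where
  pos := by
    intro a ha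
    obtain ⟨i, hi, rfl⟩ := Multiset.mem_map.1 ha
    obtain ⟨v, hv⟩ := h.exists_color i hi
    exact (Set.ncard_pos (Set.toFinite _)).2 ⟨v, hv⟩
  mantel := four_mul_ncard_edgeSet_le _ h.cliqueFree
  sum := by
    have h1 := h.ncard_cliqueSet 1
    rw [cliquePoly_coeff_one, ncard_cliqueSet_one] at h1
    exact_mod_cast h1.symm
  edges := by rw [← h.ncard_cliqueSet 2, ncard_edgeSet_eq]

end IsRep

/-- The colouring may take several values on `S`; they are collapsed into the single colour `none`,
and G[S] is the added triangle-free graph. `S` must be nonempty for this colour to occur. -/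
lemma IsRep.mem_familyK {n e : ℕ} {ι : Type*} {G : SimpleGraph (Fin n)} {c : Fin n → ι}
    {Q : Finset ι} {S : Set (Fin n)} (h : IsRep G c Q S) (hS : S.Nonempty)
    (he : G.edgeSet.ncard = e) : G ∈ familyK n e := by
  classical
  refine ⟨he, ?_⟩
  let f := Fintype.equivFin (Option Q)
  let d : Fin n → Option Q := fun v => if hv : c v ∈ Q then some ⟨c v, hv⟩ else none
  have hd : ∀ v, d v = none ↔ v ∈ S := by
    intro v
    rw [h.mem_iff]
    by_cases hv : c v ∈ Q <;> simp [d, hv]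
  have hdd : ∀ u v, ¬ (u ∈ S ∧ v ∈ S) → (d u = d v ↔ c u = c v) := by
    intro u v huv
    rw [h.mem_iff, h.mem_iff] at huv
    by_cases hu : c u ∈ Q <;> by_cases hv : c v ∈ Q
    · simp [d, hu, hv]
    · simp only [d, hu, hv, dite_true, dite_false, reduceCtorEq, false_iff]
      intro h'; exact hv (h' ▸ hu)
    · simp only [d, hu, hv, dite_true, dite_false, reduceCtorEq, false_iff]
      intro h'; exact hu (h' ▸ hv)
    · exact absurd ⟨hu, hv⟩ huv
  have hfd : ∀ v, f (d v) = f none ↔ v ∈ S := fun v => by rw [f.injective.eq_iff, hd]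
  let J : SimpleGraph (Fin n) :=
    { Adj := fun u v => G.Adj u v ∧ u ∈ S ∧ v ∈ S
      symm := ⟨fun u v huv => ⟨huv.1.symm, huv.2.2, huv.2.1⟩⟩
      loopless := ⟨fun u hu => G.loopless.irrefl u hu.1⟩ }
  refine ⟨_, fun v => f (d v), f none, J, ?_, ?_, ?_, ?_⟩
  · intro a
    obtain ⟨b, rfl⟩ := f.surjective a
    cases b with
    | none =>
      obtain ⟨v, hv⟩ := hS
      exact ⟨v, by simp only [(hd v).2 hv]⟩
    | some i =>
      obtain ⟨v, hv⟩ := h.exists_color i.1 i.2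
      refine ⟨v, ?_⟩
      have : d v = some i := by
        have hvQ : c v ∈ Q := hv ▸ i.2
        simp only [d, hvQ, dite_true]
        congr 1
        exact Subtype.ext hv
      simp only [this]
  · intro s hs
    have hsS : (s : Set (Fin n)) ⊆ S := by
      intro u hu
      obtain ⟨v, hv, hvu⟩ := Finset.exists_mem_ne (by rw [hs.card_eq]; norm_num) u
      exact (hs.isClique hu hv hvu.symm).2.1
    have hmem : s ∈ cliquesIn G S 3 :=
      ⟨hsS, fun u hu v hv huv => (hs.isClique hu hv huv).1, hs.card_eq⟩
    have h0 : (cliquesIn G S 3).ncard = 0 := by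
      rw [ncard_cliquesIn_eq, h.cliqueFree.cliqueSet, Set.ncard_empty]
    rw [Set.ncard_eq_zero] at h0
    rw [h0] at hmem
    exact hmem
  · intro u v huv
    exact ⟨(hfd u).2 huv.2.1, (hfd v).2 huv.2.2⟩
  · ext u v
    change G.Adj u v ↔ f (d u) ≠ f (d v) ∨ (G.Adj u v ∧ u ∈ S ∧ v ∈ S)
    rw [f.injective.ne_iff]
    by_cases huv : u ∈ S ∧ v ∈ S
    · rw [(hd u).2 huv.1, (hd v).2 huv.2]
      simp [huv]
    · rw [h.adj_iff u v huv, ne_eq, ne_eq, hdd u v huv]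
      tauto

lemma exists_isRep_of_mem_familyK {n e : ℕ} {G : SimpleGraph (Fin n)} (h : G ∈ familyK n e) :
    ∃ (l : ℕ) (c : Fin n → Fin l) (Q : Finset (Fin l)) (S : Set (Fin n)), IsRep G c Q S := by
  classical
  obtain ⟨-, l, c, p, J, hc, hJ, hJp, rfl⟩ := h
  refine ⟨l, c, Finset.univ.erase p, c ⁻¹' {p}, ?_, ?_, ?_, fun i _ => hc i⟩
  · intro v; simp
  · refine SimpleGraph.CliqueFree.anti ?_ (hJ.comap
      (SimpleGraph.Embedding.comap (Function.Embedding.subtype (· ∈ c ⁻¹' {p})) J).isContained)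
    rintro ⟨u, hu⟩ ⟨v, hv⟩ (huv | huv)
    · exact absurd ((show c u = p from hu).trans (show c v = p from hv).symm) huv
    · exact huv
  · intro u v huv
    change (c u ≠ c v ∨ J.Adj u v) ↔ c u ≠ c v
    refine ⟨?_, Or.inl⟩
    rintro (h | h)
    · exact h
    · exact absurd (hJp u v h) huv

/-- Two parts of a complete multipartite graph can be regarded as one part carrying a complete
bipartite graph. -/
lemma isRep_pair {V ι : Type*} [Finite V] (c : V → ι) (Q : Finset ι)
    (hQ : ∀ i ∈ Q, ∃ v, c v = i) {i j : ι} (hij : i ≠ j) (hS : ∀ v, c v ∈ Q ↔ c v ≠ i ∧ c v ≠ j) :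
    IsRep (multipartite c) c Q (c ⁻¹' {i, j}) ∧
    ((multipartite c).induce (c ⁻¹' {i, j})).edgeSet.ncard =
      (c ⁻¹' {i}).ncard * (c ⁻¹' {j}).ncard := by
  classical
  set W : Set V := c ⁻¹' {i, j}
  -- Applied to the graph induced on the two classes, with empty triangle-free part, the count gives
  -- (1 + aX)(1 + bX). Its coefficients 3 and 2 yield triangle-freeness and the edge number.
  have hcount := fun r => cliqueSet_ncard ((multipartite c).induce W) (fun v => c v.1) {i, j} ∅
    (by
      rintro ⟨v, hv⟩
      have hv' : c v = i ∨ c v = j := hv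
      simpa using fun h => hv'.resolve_left h)
    (SimpleGraph.cliqueFree_of_card_lt (by simp))
    (fun u v _ => Iff.rfl) r
  have hempty : ((((multipartite c).induce W).induce ∅).edgeSet).ncard = 0 := by
    rw [Set.ncard_eq_zero]
    ext z
    simp only [Set.mem_empty_iff_false, iff_false]
    induction z with
    | _ a b => exact fun _ => a.2
  have hsize : ∀ a, a = i ∨ a = j →
      ((fun v : W => c v.1) ⁻¹' {a}).ncard = (c ⁻¹' {a}).ncard := by
    intro a ha
    rw [← Set.ncard_image_of_injective _ Subtype.val_injective]
    congr 1
    ext v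
    simp only [Set.mem_image, Set.mem_preimage, Set.mem_singleton_iff, Subtype.exists,
      exists_and_left, exists_prop, exists_eq_right_right]
    refine ⟨fun h => h.1, fun h => ⟨h, ?_⟩⟩
    change c v ∈ ({i, j} : Set ι)
    rw [h]; simpa using ha
  have hval : ({i, j} : Finset ι).val = i ::ₘ j ::ₘ 0 := by
    rw [Finset.insert_val_of_notMem (by simpa using hij)]; rfl
  have hpoly : ∀ a b : ℕ, cliquePoly (a ::ₘ b ::ₘ 0) 0 0 = cliquePoly 0 (a + b) (a * b) := by
    intro a b
    rw [cliquePoly_add_pair]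
    simp [cliquePoly]
  rw [hempty, hval] at hcount
  simp only [Multiset.map_cons, Multiset.map_zero, hsize i (Or.inl rfl),
    hsize j (Or.inr rfl), Set.ncard_empty, hpoly] at hcount
  refine ⟨⟨?_, ?_, fun u v _ => Iff.rfl, hQ⟩, ?_⟩
  · intro v
    rw [hS]
    simp only [W, Set.mem_preimage, Set.mem_insert_iff, Set.mem_singleton_iff]
    tauto
  · have h3 := hcount 3
    rw [cliquePoly_coeff_add_two] at h3
    rw [← SimpleGraph.cliqueSet_eq_empty_iff, ← Set.ncard_eq_zero]
    simpa [coeff_one] using h3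
  · have h2 := hcount 2
    rw [← ncard_edgeSet_eq, cliquePoly_coeff_add_two] at h2
    simp [coeff_one] at h2
    exact_mod_cast h2

lemma exists_bijOn_of_map_eq {ι κ α : Type*} [Nonempty κ] (f : ι → α) (f' : κ → α)
    (Q : Finset ι) (Q' : Finset κ) (h : Q.val.map f = Q'.val.map f') :
    ∃ g : ι → κ, Set.BijOn g Q Q' ∧ ∀ i ∈ Q, f' (g i) = f i := by
  classical
  induction Q using Finset.induction_on generalizing Q' with
  | empty =>
    have hQ' : Q' = ∅ := by
      rw [← Finset.val_eq_zero, ← Multiset.map_eq_zero (f := f'), ← h]; rfl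
    subst hQ'
    exact ⟨fun _ => Classical.arbitrary κ, by simp, by simp⟩
  | insert i Q hi ih =>
    rw [Finset.insert_val_of_notMem hi, Multiset.map_cons] at h
    have hmem : f i ∈ Q'.val.map f' := h ▸ Multiset.mem_cons_self _ _
    obtain ⟨j, hj, hji⟩ := Multiset.mem_map.1 hmem
    have hj' : j ∈ Q' := hj
    rw [← Finset.insert_erase hj', Finset.insert_val_of_notMem (Finset.notMem_erase _ _),
      Multiset.map_cons, hji, Multiset.cons_inj_right] at h
    obtain ⟨g, hg, hgf⟩ := ih _ h
    have hne : ∀ v ∈ Q, v ≠ i := fun v hv hvi => hi (hvi ▸ hv)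
    refine ⟨Function.update g i j, ?_, ?_⟩
    · have h1 : Set.BijOn (Function.update g i j) Q (Q'.erase j : Finset κ) :=
        hg.congr fun v hv => (Function.update_of_ne (hne v hv) _ _).symm
      have h2 := h1.insert (a := i) (by simp)
      rw [Function.update_self] at h2
      rwa [← Finset.coe_insert, ← Finset.coe_insert, Finset.insert_erase hj'] at h2
    · intro v hv
      rcases Finset.mem_insert.1 hv with rfl | hv
      · rw [Function.update_self, hji]
      · rw [Function.update_of_ne (hne v hv), hgf v hv]

/-- Equal multisets of sizes allow the classes outside `S` to be relabelled as the A_j^*. Inside `S`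
the graph is arbitrary triangle-free, so any split of `S` into sets of sizes a_i^* and a_k^* will
do. -/
lemma IsRep.mem_familyHOneStar {n e x y m q i : ℕ} {R : Multiset ℕ}
    (hd : IsStarData n e R x y m q) {ι : Type*} {G : SimpleGraph (Fin n)} {c : Fin n → ι}
    {Q : Finset ι} {S : Set (Fin n)} (h : IsRep G c Q S)
    (hp : IsReplacementParam n e i ((G.induce S).edgeSet.ncard : ℕ))
    (hQ : classSizes c Q = otherParts n e i)
    (hS : S.ncard = starPart n e i + starPart n e (chromaticParam n e)) :
    G ∈ familyHOneStar n e := by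
  classical
  have hi := hd.mem_of_isReplacementParam hp
  set k := chromaticParam n e with hk
  have hk2 : 2 ≤ k := by rw [hk, hd.chromaticParam_eq]; omega
  obtain ⟨hi1, hik⟩ := Finset.mem_Icc.1 hi
  obtain ⟨g, hg, hgf⟩ := exists_bijOn_of_map_eq (fun i => (c ⁻¹' {i}).ncard) (starPart n e)
    Q ((Finset.Icc 1 (k - 1)).erase i) hQ
  obtain ⟨S₁, hS₁, hcard⟩ := Set.exists_subset_card_eq (s := S) (n := starPart n e i) (by omega)
  let d : Fin n → ℕ := fun v => if c v ∈ Q then g (c v) else if v ∈ S₁ then i else k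
  have hgmem : ∀ v, c v ∈ Q → 1 ≤ g (c v) ∧ g (c v) ≤ k - 1 ∧ g (c v) ≠ i := by
    intro v hv
    have := hg.mapsTo hv
    rw [Finset.mem_coe, Finset.mem_erase, Finset.mem_Icc] at this
    tauto
  have hd1 : ∀ v, c v ∈ Q → d v = g (c v) := fun v hv => if_pos hv
  have hd2 : ∀ v ∈ S₁, d v = i := by
    intro v hv
    simp only [d]
    rw [if_neg ((h.mem_iff v).1 (hS₁ hv)), if_pos hv]
  have hd3 : ∀ v ∈ S, v ∉ S₁ → d v = k := by
    intro v hv hv1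
    simp only [d]
    rw [if_neg ((h.mem_iff v).1 hv), if_neg hv1]
  have hcases : ∀ v, c v ∈ Q ∨ v ∈ S₁ ∨ (v ∈ S ∧ v ∉ S₁) := by
    intro v
    have := h.mem_iff v
    tauto
  have hSd : d ⁻¹' {i, k} = S := by
    ext v
    simp only [Set.mem_preimage, Set.mem_insert_iff, Set.mem_singleton_iff]
    rcases hcases v with hv | hv | ⟨hv, hv1⟩
    · have h1 := hgmem v hv
      rw [hd1 v hv, h.mem_iff]
      simp only [hv, not_true_eq_false, iff_false]
      omega
    · simp [hd2 v hv, hS₁ hv]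
    · simp [hd3 v hv hv1, hv]
  rw [ErdosRademacher.mem_familyHOneStar]
  refine ⟨d, i, _, ?_, ?_, hp, ?_⟩
  · intro v
    rw [Finset.mem_Icc]
    rcases hcases v with hv | hv | ⟨hv, hv1⟩
    · have h1 := hgmem v hv
      rw [hd1 v hv]; omega
    · rw [hd2 v hv]; omega
    · rw [hd3 v hv hv1]; omega
  · intro j hj
    obtain ⟨hj1, hjk⟩ := Finset.mem_Icc.1 hj
    by_cases hjk' : j = k
    · have : d ⁻¹' {j} = S \ S₁ := by
        ext v
        simp only [Set.mem_preimage, Set.mem_singleton_iff, Set.mem_sdiff]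
        rcases hcases v with hv | hv | ⟨hv, hv1⟩
        · have h1 := hgmem v hv
          have h2 := h.mem_iff v
          rw [hd1 v hv]
          constructor
          · intro h3; omega
          · rintro ⟨h3, -⟩; exact absurd hv (h2.1 h3)
        · rw [hd2 v hv]
          simp only [hv, not_true_eq_false, and_false, iff_false]
          omega
        · simp [hd3 v hv hv1, hv, hv1, hjk']
      rw [this, Set.ncard_sdiff hS₁, hS, hcard, hjk', Nat.add_sub_cancel_left]
    · by_cases hji : j = i
      · have : d ⁻¹' {j} = S₁ := by
          ext v
          simp only [Set.mem_preimage, Set.mem_singleton_iff]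
          rcases hcases v with hv | hv | ⟨hv, hv1⟩
          · have h1 := hgmem v hv
            rw [hd1 v hv]
            constructor
            · intro h3; omega
            · intro h3; exact absurd hv ((h.mem_iff v).1 (hS₁ h3))
          · simp [hd2 v hv, hv, hji]
          · rw [hd3 v hv hv1]
            simp only [hv1, iff_false]
            omega
        rw [this, hcard, hji]
      · obtain ⟨a, ha, rfl⟩ := hg.surjOn (show j ∈ (((Finset.Icc 1 (k - 1)).erase i : Finset ℕ) :
            Set ℕ) by
          rw [Finset.mem_coe, Finset.mem_erase, Finset.mem_Icc]; omega)
        rw [hgf a ha]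
        congr 1
        ext v
        simp only [Set.mem_preimage, Set.mem_singleton_iff]
        rcases hcases v with hv | hv | ⟨hv, hv1⟩
        · rw [hd1 v hv, hg.injOn.eq_iff hv ha]
        · rw [hd2 v hv]
          constructor
          · intro h3; omega
          · intro h3; exact absurd (h3 ▸ ha) ((h.mem_iff v).1 (hS₁ hv))
        · rw [hd3 v hv hv1]
          constructor
          · intro h3; omega
          · intro h3; exact absurd (h3 ▸ ha) ((h.mem_iff v).1 hv)
  · rw [hSd]
    refine ⟨h.cliqueFree, rfl, fun u v huv => ?_⟩
    rw [h.adj_iff u v huv]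
    change _ ↔ d u ≠ d v
    rw [not_iff_not]
    rcases hcases u with hu | hu | ⟨hu, hu1⟩ <;> rcases hcases v with hv | hv | ⟨hv, hv1⟩
    · rw [hd1 u hu, hd1 v hv, hg.injOn.eq_iff hu hv]
    · have h1 := hgmem u hu
      rw [hd1 u hu, hd2 v hv]
      constructor
      · intro h3; exact absurd (h3 ▸ hu) ((h.mem_iff v).1 (hS₁ hv))
      · intro h3; omega
    · have h1 := hgmem u hu
      rw [hd1 u hu, hd3 v hv hv1]
      constructor
      · intro h3; exact absurd (h3 ▸ hu) ((h.mem_iff v).1 hv)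
      · intro h3; omega
    · have h1 := hgmem v hv
      rw [hd2 u hu, hd1 v hv]
      constructor
      · intro h3; exact absurd (h3 ▸ hv) ((h.mem_iff u).1 (hS₁ hu))
      · intro h3; omega
    · exact absurd ⟨hS₁ hu, hS₁ hv⟩ huv
    · exact absurd ⟨hS₁ hu, hv⟩ huv
    · have h1 := hgmem v hv
      rw [hd3 u hu hu1, hd1 v hv]
      constructor
      · intro h3; exact absurd (h3 ▸ hv) ((h.mem_iff u).1 hu)
      · intro h3; omega
    · exact absurd ⟨hu, hS₁ hv⟩ huv
    · exact absurd ⟨hu, hv⟩ huv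

/-- The graphs in `familyHOneStar n e` belong to `familyK n e` and have `hStar r n e` cliques. -/
lemma mem_familyK_of_mem_familyHOneStar {n e x y m q : ℕ} {R : Multiset ℕ}
    (hd : IsStarData n e R x y m q) (hs : IsStar R x y m) (hc : IsConfig n e R (x + y) q)
    (hq : q + m = x * y) {G : SimpleGraph (Fin n)} (hG : G ∈ familyHOneStar n e) :
    G ∈ familyK n e ∧ ∀ r, 2 ≤ r → (cliqueCount r G : ℤ) = hStar r n e := by
  classical
  obtain ⟨c, i, q', h1, h2, hp, hfree, hq', hadj⟩ := mem_familyHOneStar.1 hG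
  have hi := hd.mem_of_isReplacementParam hp
  obtain ⟨hi1, hik⟩ := Finset.mem_Icc.1 hi
  have hpos : ∀ j ∈ Finset.Icc 1 (chromaticParam n e), 1 ≤ starPart n e j := by
    intro j hj
    obtain ⟨hj1, hjk⟩ := Finset.mem_Icc.1 hj
    by_cases hjk' : j = chromaticParam n e
    · rw [hjk', hd.chromaticParam_eq, hd.starPart_last]; exact hs.one_le
    · have : starPart n e j ∈ x ::ₘ R := by
        rw [← hd.map_eq]
        exact Multiset.mem_map_of_mem _ (Finset.mem_Icc.2 ⟨hj1, by omega⟩)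
      rcases Multiset.mem_cons.1 this with h | h
      · have := hs.one_le
        have := hs.le
        omega
      · exact hc.pos _ h
  set k := chromaticParam n e with hk
  have hrep : IsRep G c ((Finset.Icc 1 (k - 1)).erase i) (c ⁻¹' {i, k}) := by
    refine ⟨fun v => ?_, hfree, hadj, fun j hj => ?_⟩
    · have := Finset.mem_Icc.1 (h1 v)
      simp only [Set.mem_preimage, Set.mem_insert_iff, Set.mem_singleton_iff, Finset.mem_erase,
        Finset.mem_Icc]
      omega
    · rw [Finset.mem_erase, Finset.mem_Icc] at hj
      have hj' : j ∈ Finset.Icc 1 k := Finset.mem_Icc.2 (by omega)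
      have h3 := hpos j hj'
      rw [← h2 j hj'] at h3
      exact (Set.ncard_pos (Set.toFinite _)).1 h3
  have hsizes : classSizes c ((Finset.Icc 1 (k - 1)).erase i) = otherParts n e i := by
    refine Multiset.map_congr rfl fun j hj => h2 j ?_
    have := Finset.mem_Icc.1 (Finset.mem_of_mem_erase (Finset.mem_def.2 hj))
    exact Finset.mem_Icc.2 (by omega)
  have hScard : (c ⁻¹' {i, k}).ncard = starPart n e i + starPart n e k := by
    rw [← h2 i (Finset.mem_Icc.2 (by omega)), ← h2 k (Finset.mem_Icc.2 (by omega)),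
      ← Set.ncard_union_eq]
    · congr 1
    · rw [Set.disjoint_left]
      intro v hv hv'
      have h3 : c v = i := hv
      have h4 : c v = k := hv'
      omega
  rw [← hq'] at hp
  have hcount : ∀ r, ((G.cliqueSet r).ncard : ℤ) = (cliquePoly R (x + y) q).coeff r := by
    intro r
    rw [hrep.ncard_cliqueSet, hsizes, hScard, hd.cliquePoly_otherParts hq hp]
  refine ⟨hrep.mem_familyK ?_ ?_, fun r hr => ?_⟩
  · rw [← Set.ncard_pos (Set.toFinite _), hScard]
    have := hpos i (Finset.mem_Icc.2 (by omega))
    omega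
  · have := hcount 2
    rw [← ncard_edgeSet_eq, hc.edges] at this
    exact_mod_cast this
  · rw [cliqueCount, hcount, hd.hStar_eq r hr]

/-! ### Existence of a graph in ℋ₁^* -/

lemma exists_coloring {n : ℕ} (I : Finset ℕ) (a : ℕ → ℕ) (h : ∑ i ∈ I, a i = n) :
    ∃ c : Fin n → ℕ, (∀ v, c v ∈ I) ∧ ∀ i ∈ I, (c ⁻¹' {i}).ncard = a i := by
  let f : (Σ i : I, Fin (a i)) ≃ Fin n := Fintype.equivFinOfCardEq (by
    rw [Fintype.card_sigma]
    simp only [Fintype.card_fin]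
    rw [← h, Finset.sum_coe_sort I a])
  refine ⟨fun v => (f.symm v).1, fun v => (f.symm v).1.2, fun i hi => ?_⟩
  have : (fun v => ((f.symm v).1 : ℕ)) ⁻¹' {i} =
      (fun t : Fin (a i) => f ⟨⟨i, hi⟩, t⟩) '' Set.univ := by
    ext v
    simp only [Set.mem_preimage, Set.mem_singleton_iff, Set.image_univ, Set.mem_range]
    constructor
    · rintro rfl
      exact ⟨(f.symm v).2, f.apply_symm_apply v⟩
    · rintro ⟨t, rfl⟩
      rw [Equiv.symm_apply_apply]
  rw [this, Set.ncard_image_of_injective, Set.ncard_univ, Nat.card_eq_fintype_card,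
    Fintype.card_fin]
  intro s t hst
  have := f.injective hst
  simpa using this

lemma familyHOneStar_nonempty {n e x y m q : ℕ} {R : Multiset ℕ}
    (hd : IsStarData n e R x y m q) (hc : IsConfig n e R (x + y) q) (hq : q + m = x * y) :
    (familyHOneStar n e).Nonempty := by
  classical
  have hk := hd.chromaticParam_eq
  obtain ⟨c, h1, h2⟩ := exists_coloring (n := n) (Finset.Icc 1 (chromaticParam n e))
    (starPart n e) (by
      rw [← Finset.sum_map_val, hk, Icc_succ_val_map, Icc_succ_val_map, hd.map_starPart,
        hd.starPart_middle, hd.starPart_last, Multiset.sum_cons, Multiset.sum_cons, ← hc.sum]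
      ring)
  set T := multipartite c with hT
  set S : Set (Fin n) := c ⁻¹' {R.card + 1, chromaticParam n e} with hS
  have hcards : (c ⁻¹' {R.card + 1}).ncard = x ∧ (c ⁻¹' {chromaticParam n e}).ncard = y := by
    rw [h2 _ (Finset.mem_Icc.2 (by omega)), h2 _ (Finset.mem_Icc.2 (by omega)),
      hd.starPart_middle, hk, hd.starPart_last]
    exact ⟨rfl, rfl⟩
  obtain ⟨hrep, hedges⟩ := isRep_pair c ((Finset.univ.image c).filter
      fun j => j ≠ R.card + 1 ∧ j ≠ chromaticParam n e)
    (by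
      intro j hj
      obtain ⟨v, -, hv⟩ := Finset.mem_image.1 (Finset.mem_filter.1 hj).1
      exact ⟨v, hv⟩)
    (show R.card + 1 ≠ chromaticParam n e by omega) (by intro v; simp)
  rw [← hT, ← hS, hcards.1, hcards.2] at hedges
  -- Keeping any q of the xy edges between the last two parts preserves triangle-freeness.
  obtain ⟨E, hE, hEcard⟩ := Set.exists_subset_card_eq (s := (T.induce S).edgeSet) (n := q)
    (by omega)
  have hle : SimpleGraph.fromEdgeSet E ≤ T.induce S := by
    intro u v huv
    exact hE ((SimpleGraph.fromEdgeSet_adj _).1 huv).1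
  let G : SimpleGraph (Fin n) :=
    { Adj := fun u v => (¬ (u ∈ S ∧ v ∈ S) ∧ T.Adj u v) ∨
        ∃ (hu : u ∈ S) (hv : v ∈ S), (SimpleGraph.fromEdgeSet E).Adj ⟨u, hu⟩ ⟨v, hv⟩
      symm := ⟨by
        rintro u v (⟨h3, h4⟩ | ⟨hu, hv, h4⟩)
        · exact Or.inl ⟨fun h => h3 h.symm, h4.symm⟩
        · exact Or.inr ⟨hv, hu, h4.symm⟩⟩
      loopless := ⟨by
        rintro u (⟨-, h4⟩ | ⟨hu, hv, h4⟩)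
        · exact T.loopless.irrefl u h4
        · exact SimpleGraph.irrefl _ h4⟩ }
  have hind : G.induce S = SimpleGraph.fromEdgeSet E := by
    ext ⟨u, hu⟩ ⟨v, hv⟩
    change ((¬ (u ∈ S ∧ v ∈ S) ∧ T.Adj u v) ∨ ∃ (hu : u ∈ S) (hv : v ∈ S), _) ↔ _
    constructor
    · rintro (⟨h3, -⟩ | ⟨_, _, h4⟩)
      · exact absurd ⟨hu, hv⟩ h3
      · exact h4
    · intro h4
      exact Or.inr ⟨hu, hv, h4⟩
  refine ⟨G, mem_familyHOneStar.2 ⟨c, R.card + 1, q, h1, h2, hd.isReplacementParam_last hq, ?_⟩⟩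
  rw [← hS]
  refine ⟨?_, ?_, fun u v huv => ?_⟩
  · rw [hind]; exact hrep.cliqueFree.anti hle
  · rw [hind, SimpleGraph.edgeSet_fromEdgeSet, ← hEcard]
    congr 2
    ext z
    simp only [Set.mem_sdiff, and_iff_left_iff_imp]
    exact fun hz => SimpleGraph.not_isDiag_of_mem_edgeSet _ (hE hz)
  · change ((¬ (u ∈ S ∧ v ∈ S) ∧ T.Adj u v) ∨ ∃ (hu : u ∈ S) (hv : v ∈ S), _) ↔ _
    constructor
    · rintro (⟨-, h4⟩ | ⟨hu, hv, -⟩)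
      · exact h4
      · exact absurd ⟨hu, hv⟩ huv
    · exact fun h4 => Or.inl ⟨huv, h4⟩

/-! ### Uniqueness -/

/-- The number of parts is bounded below by the number of edges. -/
lemma IsConfig.le_card_add_two {n e r b q : ℕ} {R : Multiset ℕ} (h : IsConfig n e R b q)
    (he : turanNumber (r - 1) n < e) : r ≤ R.card + 2 := by
  by_contra hcon
  have h1 := turanNumber_mono (show 1 ≤ R.card + 2 by omega)
    (show R.card + 2 ≤ r - 1 by omega) n
  have h2 := h.le_turanNumber
  omega

/-- Complete multipartite graphs with the minimum number of cliques. -/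
lemma multipartite_mem_familyHOneStar {n e r : ℕ} (he : 1 ≤ e) (hr : 3 ≤ r)
    (her : turanNumber (r - 1) n < e) {ι : Type*} (c : Fin n → ι)
    (hedges : (multipartite c).edgeSet.ncard = e)
    (hmin : (cliqueCount r (multipartite c) : ℤ) = hStar r n e) :
    multipartite c ∈ familyHOneStar n e := by
  classical
  -- Unused colours are dropped, so that a smallest colour class is a genuine part.
  wlog hc : ∃ _ : Fintype ι, Function.Surjective c generalizing ι
  · have heq : multipartite c = multipartite (Set.rangeFactorization c) := by
      ext u v
      change c u ≠ c v ↔ Set.rangeFactorization c u ≠ Set.rangeFactorization c v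
      rw [ne_eq, ne_eq, Subtype.ext_iff]; rfl
    rw [heq] at hedges hmin ⊢
    exact this _ hedges hmin ⟨Fintype.ofFinite _, Set.rangeFactorization_surjective⟩
  obtain ⟨_, hc⟩ := hc
  obtain ⟨z, hz⟩ : (multipartite c).edgeSet.Nonempty := by
    rw [← Set.ncard_pos (Set.toFinite _)]; omega
  obtain ⟨u, v, huv⟩ : ∃ u v, c u ≠ c v := by
    induction z with
    | _ u v => exact ⟨u, v, hz⟩
  -- The two smallest parts form the triangle-free part. Then m = 0 and all other parts are at least
  -- x, which is the sorted case of `IsConfig.isStar_of_coeff_eq`.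
  obtain ⟨α, -, hα⟩ := Finset.univ.exists_min_image (fun i => (c ⁻¹' {i}).ncard)
    ⟨c u, Finset.mem_univ _⟩
  obtain ⟨β, hβ, hβmin⟩ := (Finset.univ.erase α).exists_min_image (fun i => (c ⁻¹' {i}).ncard) (by
    by_cases h : c u = α
    · exact ⟨c v, by simpa [h] using huv.symm⟩
    · exact ⟨c u, by simpa using h⟩)
  have hβα : β ≠ α := Finset.ne_of_mem_erase hβ
  obtain ⟨hrep, hpair⟩ := isRep_pair c ((Finset.univ.erase α).erase β) (fun i _ => hc i) hβα (by
    intro v; simp)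
  have hScard : (c ⁻¹' {β, α}).ncard = (c ⁻¹' {β}).ncard + (c ⁻¹' {α}).ncard := by
    rw [← Set.ncard_union_eq]
    · congr 1
    · rw [Set.disjoint_left]
      intro v hv hv'
      exact hβα (Eq.trans (Eq.symm hv) hv')
  set x := (c ⁻¹' {β}).ncard
  set y := (c ⁻¹' {α}).ncard with hy
  have hconf := hrep.isConfig
  rw [hedges, hpair, hScard, Nat.card_eq_fintype_card, Fintype.card_fin] at hconf
  have hy1 : 1 ≤ y := (Set.ncard_pos (Set.toFinite _)).2 (hc α)
  have hyx : y ≤ x := hα β (Finset.mem_univ _)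
  have hcoeff := hrep.ncard_cliqueSet r
  rw [hpair, hScard] at hcoeff
  have hstar : IsStar _ x y 0 := hconf.isStar_of_coeff_eq he hr (hconf.le_card_add_two her)
    (by ring) hy1 (by omega) (Or.inr (by
      intro a ha
      obtain ⟨i, hi, rfl⟩ := Multiset.mem_map.1 ha
      exact hβmin i (Finset.mem_of_mem_erase (Finset.mem_def.2 hi)))) (by
      rw [← hmin, cliqueCount, hcoeff])
  have hd := hstar.isStarData hconf (by ring)
  refine hrep.mem_familyHOneStar hd ?_ hd.otherParts_last.symm ?_
  · rw [hpair]
    exact hd.isReplacementParam_last (by ring)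
  · rw [hScard, hd.starPart_middle, hd.chromaticParam_eq, hd.starPart_last]

lemma IsRep.exists_eq_multipartite {V ι κ : Type*} {G : SimpleGraph V} {c : V → ι}
    {Q : Finset ι} {S : Set V} (h : IsRep G c Q S) (d : V → κ)
    (hd : ∀ u ∈ S, ∀ v ∈ S, G.Adj u v ↔ d u ≠ d v) :
    ∃ f : V → ι ⊕ κ, G = multipartite f := by
  classical
  refine ⟨fun v => if c v ∈ Q then Sum.inl (c v) else Sum.inr (d v), ?_⟩
  ext u v
  change _ ↔ (if c u ∈ Q then Sum.inl (c u) else Sum.inr (d u)) ≠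
    (if c v ∈ Q then Sum.inl (c v) else Sum.inr (d v))
  by_cases hu : c u ∈ Q <;> by_cases hv : c v ∈ Q
  · rw [h.adj_iff u v (fun h' => (h.mem_iff u).1 h'.1 hu)]
    simp [hu, hv]
  · rw [h.adj_iff u v (fun h' => (h.mem_iff u).1 h'.1 hu)]
    simp only [hu, hv, if_true, if_false, ne_eq, reduceCtorEq, not_false_eq_true, iff_true]
    intro h'; exact hv (h' ▸ hu)
  · rw [h.adj_iff u v (fun h' => (h.mem_iff v).1 h'.2 hv)]
    simp only [hu, hv, if_true, if_false, ne_eq, reduceCtorEq, not_false_eq_true, iff_true]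
    intro h'; exact hu (h' ▸ hv)
  · rw [hd u ((h.mem_iff u).2 hu) v ((h.mem_iff v).2 hv)]
    simp [hu, hv]

/-- The uniqueness part of Mantel's theorem. -/
lemma exists_bicoloring_of_mantel {V : Type*} [Finite V] (G : SimpleGraph V)
    (hfree : G.CliqueFree 3) (hG : Nat.card V ^ 2 ≤ 4 * G.edgeSet.ncard + 1) :
    ∃ d : V → ℕ, ∀ u v, G.Adj u v ↔ d u ≠ d v := by
  classical
  have := Fintype.ofFinite V
  -- Every triangle-free H satisfies 4|E(H)| ≤ |V|² ≤ 4|E(G)| + 1, whence |E(H)| ≤ |E(G)| by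
  -- integrality.
  have hmax : G.IsTuranMaximal 2 := by
    refine ⟨hfree, fun H _ hH => ?_⟩
    have h1 := four_mul_ncard_edgeSet_le H hH
    rw [← SimpleGraph.coe_edgeFinset, Set.ncard_coe_finset] at h1 hG
    omega
  obtain ⟨f⟩ := (SimpleGraph.isTuranMaximal_iff_nonempty_iso_turanGraph (by norm_num)).1 hmax
  refine ⟨fun v => (f v : ℕ) % 2, fun u v => ?_⟩
  rw [← f.map_adj_iff]
  rfl

/-- For m > 0 the configuration is already a star. For q = 0 the graph is complete multipartite. For
m = 0 and q > 0 the sizes x, y, R must first be sorted, since the given pair x, y need not consist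
of the two smallest. -/
theorem mem_familyHOneStar_of_cliqueCount_eq {n e r : ℕ} (he : 1 ≤ e) (hr : 3 ≤ r)
    (her : turanNumber (r - 1) n < e) {G : SimpleGraph (Fin n)} (hG : G ∈ familyK n e)
    (hmin : (cliqueCount r G : ℤ) = hStar r n e) : G ∈ familyHOneStar n e := by
  classical
  have hedges : G.edgeSet.ncard = e := hG.1
  obtain ⟨l, c, Q, S, hrep⟩ := exists_isRep_of_mem_familyK hG
  have hmulti : ∀ d : Fin n → ℕ, (∀ u ∈ S, ∀ v ∈ S, G.Adj u v ↔ d u ≠ d v) →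
      G ∈ familyHOneStar n e := by
    intro d hd
    obtain ⟨f, rfl⟩ := hrep.exists_eq_multipartite d hd
    exact multipartite_mem_familyHOneStar he hr her f hedges hmin
  have hconf := hrep.isConfig
  rw [hedges, Nat.card_eq_fintype_card, Fintype.card_fin] at hconf
  have hcoeff := hrep.ncard_cliqueSet r
  rw [← cliqueCount, hmin] at hcoeff
  obtain ⟨q, hq⟩ : ∃ q, q = (G.induce S).edgeSet.ncard := ⟨_, rfl⟩
  obtain ⟨x, y, m, hxy, hmy, hqm, hqy⟩ := exists_canonical hconf.mantel
  rw [← hq] at hconf hcoeff hqm hqy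
  rw [← hxy] at hconf hcoeff
  have hcard := hconf.le_card_add_two her
  rcases Nat.eq_zero_or_pos q with h0 | h0
  · refine hmulti (fun _ => 0) fun u hu v hv => ?_
    simp only [ne_eq, not_true_eq_false, iff_false]
    intro huv
    rw [h0, eq_comm, Set.ncard_eq_zero] at hq
    have : s((⟨u, hu⟩ : S), (⟨v, hv⟩ : S)) ∈ (G.induce S).edgeSet := huv
    rw [hq] at this
    exact this
  have hy := hqy h0
  rcases Nat.eq_zero_or_pos m with hm0 | hm0
  · have hqxy : q = x * y := by omega
    rw [hqxy] at hconf hcoeff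
    obtain ⟨x', y', R', hD, hyx', hR'⟩ :=
      exists_cons_cons_min (x ::ₘ y ::ₘ classSizes c Q) (by simp)
    have hconf' := isConfig_of_pair hconf (by omega) hy hD
    have hy' : 1 ≤ y' := by
      have : y' ∈ x ::ₘ y ::ₘ classSizes c Q := by rw [hD]; simp
      rcases Multiset.mem_cons.1 this with h | h
      · omega
      rcases Multiset.mem_cons.1 h with h | h
      · omega
      · exact hconf.pos _ h
    have hstar : IsStar R' x' y' 0 := hconf'.isStar_of_coeff_eq he hr
      (hconf'.le_card_add_two her) (by ring) hy' (by omega) (Or.inr hR') (by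
        rw [cliquePoly_add_pair, ← hD, ← cliquePoly_add_pair, hcoeff])
    have hd := hstar.isStarData hconf' (by ring)
    -- If y is the smallest size a_k^*, then x is some a_i^* with i < k, and the triangle-free graph
    -- on `S` is one of the allowed replacements.
    by_cases hyy : y = y'
    · have hD' : x ::ₘ classSizes c Q = x' ::ₘ R' := by
        rw [hyy, Multiset.cons_swap, Multiset.cons_swap x', Multiset.cons_inj_right] at hD
        exact hD
      obtain ⟨i, hi, hix⟩ : ∃ i ∈ Finset.Icc 1 (chromaticParam n e - 1), starPart n e i = x := by
        have : x ∈ (Finset.Icc 1 (chromaticParam n e - 1)).val.map (starPart n e) := by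
          rw [hd.map_eq, ← hD']; exact Multiset.mem_cons_self _ _
        obtain ⟨i, hi, hix⟩ := Multiset.mem_map.1 this
        exact ⟨i, hi, hix⟩
      have hlast : starPart n e (chromaticParam n e) = y := by
        rw [hd.chromaticParam_eq, hd.starPart_last, hyy]
      refine hrep.mem_familyHOneStar hd (i := i) ?_ ?_ ?_
      · refine Or.inl ⟨by rw [hd.mStar_eq]; rfl, hi, ?_⟩
        rw [← hq, hqxy, hix, hlast]; push_cast; rfl
      · have := hd.cons_otherParts hi
        rw [hix, ← hD', Multiset.cons_inj_right] at this
        exact this.symm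
      · rw [← hxy, hix, hlast]
    · have hmem : ∀ a ∈ x ::ₘ y ::ₘ classSizes c Q, a = x' ∨ a = x' + 1 ∨ a = y' := by
        intro a ha
        rw [hD] at ha
        rcases Multiset.mem_cons.1 ha with h | h
        · exact Or.inl h
        rcases Multiset.mem_cons.1 h with h | h
        · exact Or.inr (Or.inr h)
        · rcases hstar.balanced a h with h | h
          · exact Or.inl h
          · exact Or.inr (Or.inl h)
      have h1 := hmem x (by simp)
      have h2 := hmem y (by simp)
      -- Otherwise x and y both lie in {x', x' + 1}, so xy = ⌊(x + y)²/4⌋. Mantel's uniqueness makes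
      -- G[S] complete bipartite, and G is complete multipartite.
      have hclose : x = y ∨ x = y + 1 := by omega
      obtain ⟨d, hd'⟩ := exists_bicoloring_of_mantel (G.induce S) hrep.cliqueFree (by
        rw [← hq, hqxy, Nat.card_coe_set_eq, ← hxy]
        rcases hclose with rfl | rfl
        · nlinarith
        · nlinarith)
      refine hmulti (fun v => if hv : v ∈ S then d ⟨v, hv⟩ else 0) fun u hu v hv => ?_
      simp only [hu, hv, dite_true]
      exact hd' ⟨u, hu⟩ ⟨v, hv⟩
  · have hstar := hconf.isStar_of_coeff_eq he hr hcard hqm hy hmy (Or.inl hm0) hcoeff.symm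
    have hd := hstar.isStarData hconf hqm
    refine hrep.mem_familyHOneStar hd ?_ hd.otherParts_last.symm ?_
    · rw [← hq]
      exact hd.isReplacementParam_last hqm
    · rw [← hxy, hd.starPart_middle, hd.chromaticParam_eq, hd.starPart_last]

end ErdosRademacher

theorem theorem1 (r n e : ℕ) (hr : 3 ≤ r) (hrn : r ≤ n) (he : 1 ≤ e) (hen : e ≤ n.choose 2) :
    IsLeast ((fun G : SimpleGraph (Fin n) => (ErdosRademacher.cliqueCount r G : ℤ)) ''
        ErdosRademacher.familyK n e)
      (ErdosRademacher.hStar r n e) ∧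
    (4 ≤ r → ErdosRademacher.turanNumber (r - 1) n < e →
      {G : SimpleGraph (Fin n) | G ∈ ErdosRademacher.familyK n e ∧
          (ErdosRademacher.cliqueCount r G : ℤ) = ErdosRademacher.hStar r n e} =
        ErdosRademacher.familyHOneStar n e) := by
  obtain ⟨R, x, y, m, q, hs, hc, hq, hd⟩ :=
    ErdosRademacher.exists_isStarData n e (by omega) he hen
  have hsub := fun G (hG : G ∈ ErdosRademacher.familyHOneStar n e) =>
    ErdosRademacher.mem_familyK_of_mem_familyHOneStar hd hs hc hq hG
  refine ⟨⟨?_, ?_⟩, fun _ her => ?_⟩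
  · obtain ⟨G, hG⟩ := ErdosRademacher.familyHOneStar_nonempty hd hc hq
    exact ⟨G, (hsub G hG).1, (hsub G hG).2 r (by omega)⟩
  · rintro _ ⟨G, hG, rfl⟩
    obtain ⟨l, c, Q, S, hrep⟩ := ErdosRademacher.exists_isRep_of_mem_familyK hG
    have hconf := hrep.isConfig
    rw [hG.1, Nat.card_eq_fintype_card, Fintype.card_fin] at hconf
    refine (hconf.hStar_le he (show 2 ≤ r by omega)).trans ?_
    rw [← hrep.ncard_cliqueSet r]
    rfl
  · ext G
    constructor
    · rintro ⟨hG, hmin⟩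
      exact ErdosRademacher.mem_familyHOneStar_of_cliqueCount_eq he hr her hG hmin
    · intro hG
      exact ⟨(hsub G hG).1, (hsub G hG).2 r (by omega)⟩
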